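/- Let $n\ge 1$, let $\mathbb H^n=\{x=(\overline x,x_n)\in\mathbb R^n: x_n>0\}$, let $y^*$ be the reflection of $y$ in $\{y_n=0\}$, and let $$K_t(x,y)=(4\pi t)^{-n/2}\left[e^{-|x-y|^2/4t}-e^{-|x-y^*|^2/4t}\right]$$ be the Dirichlet heat kernel of $\mathbb H^n$. Let $\gamma$ be a connected stable graph with vertices $V(\gamma)$ (each with a genus $g(v)$ and a valency $k(v)$), oriented edges $E(\gamma)=\{1,\dots,k\}$, $k\ge 1$, and tails $T(\gamma)$; loops and multiple edges are allowed. Write $v_1(e),v_2(e)$ for the endpoints of an edge $e$ and $v(h)$ for the vertex of a tail $h$, and order the half-edges $v^1,\dots,v^{k(v)}$ at each vertex. Let $I=(I_{i,r})$ be local functionals of degree $r$ of a scalar field on $\mathbb H^n$ with coefficients that are compactly supported and smooth up to the boundary; let $a^{I^{v^1},\dots,I^{v^{k(v)}}}$ be the coefficients of the symmetrized functional $S^{k(v)}I_{g(v),k(v)}$ placed at $v$, and let $O(\gamma)$ be the sum over $v$ of the orders of $I_{g(v),k(v)}$. For $\mathbf t=(t_1,\dots,t_k)\in(0,\infty)^k$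 and $\alpha$ smooth up to the boundary and compactly supported in $\overline{\mathbb H^n}$, put $$f_{\gamma,I}(\mathbf t)[\alpha]=\int_{(\mathbb H^n)^{V(\gamma)}}\sum\ \prod_{v}a^{I^{v^1},\dots,I^{v^{k(v)}}}(x_v)\ \prod_{e}\partial_x^{I^{e,1}}\partial_y^{I^{e,2}}K_{t_e}(x_{v_1(e)},x_{v_2(e)})\ \prod_{h\in T(\gamma)}\partial^{I^h}\alpha(x_{v(h)})\,dx ,$$ the sum being over all assignments of multi-indices to the half-edges ($I^{e,1},I^{e,2}$ are those of the two halves of $e$) with $|I^{v^1}|+\dots+|I^{v^{k(v)}}|\le \operatorname{ord}I_{g(v),k(v)}$ for each $v$. Splitting each heat kernel into its direct and its reflected term and collecting powers of the $t_e$ gives $$f_{\gamma,I}(\mathbf t)[\alpha]=\sum_{\beta:E(\gamma)\to\{1,-1\}}\ \sum_{-O(\gamma)\le|J|\le0}\ \prod_e t_e^{J_e-n/2}\int_{(\mathbb H^n)^{V(\gamma)}}e^{-\sum_eQ_e^{(\beta_e)}/4t_e}\,\Phi_{J,\beta}(x)\,dx ,$$ where $J_e\le 0$ are integers, $Q^{(1)}_e=|x_{v_1(e)}-x_{v_2(e)}|^2$,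 $Q^{(-1)}_e=|x_{v_1(e)}-x_{v_2(e)}^*|^2$, and $\Phi_{J,\beta}$ does not depend on $\mathbf t$. Choose a spanning tree of $\gamma$ and an ordering of the vertices, and use the linear coordinates $(\overline y,\overline w,z,u)$ on $(\mathbb R^n)^{V(\gamma)}$ given by $\overline y_e=\overline x_{v_1(e)}-\overline x_{v_2(e)}$ for $e$ in the tree, $\overline w=\sum_v\overline x_v$, and, in the normal direction, $x_{1,n}=u+z_1$, $x_{j,n}=u+z_j-z_{j-1}$ for $1<j<|V(\gamma)|$, $x_{|V(\gamma)|,n}=u-z_{|V(\gamma)|-1}$ (if $|V(\gamma)|=1$: $x_{1,n}=u$). For an integer $N'\ge0$ let $f^{N'}_{\gamma,I}(\mathbf t)[\alpha]$ be the expression obtained from the last formula by replacing each $\Phi_{J,\beta}$ with its Taylor polynomial of total degree $N'$ in $(\overline y,z)$ at $(\overline y,z)=(0,0)$, with $\overline w$ and $u$ held fixed. Let $\|\alpha\|_p$ be the $C^p$ norm of $\alpha$ on $\mathbb H^n$. Then there are constants $C_p\ge0$, independent of $\mathbf t$, $\alpha$ and $R$, such that for every $R>1$, every $\mathbf t\in(0,\infty)^k$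 with $t_1\le\dots\le t_k$ and $t_k^R\le t_1$, and every $\alpha$ as above, all the integrals that define $f_{\gamma,I}(\mathbf t)[\alpha]$ and $f^{N'}_{\gamma,I}(\mathbf t)[\alpha]$ converge absolutely and $$\left|f_{\gamma,I}(\mathbf t)[\alpha]-f^{N'}_{\gamma,I}(\mathbf t)[\alpha]\right|\le\Big(\sum_pC_p\prod_{h\in T(\gamma)}\|\alpha\|_{p_h}\Big)\,t_k^{\frac12(N'+1)+(|V(\gamma)|-1)\frac n2-R\,O(\gamma)-R|E(\gamma)|\frac n2},$$ where the sum is over all $p:T(\gamma)\to\mathbb Z_{\ge0}$ with $\sum_{h\in T(\gamma)}p_h\le O(\gamma)+N'+1$. -/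

import Mathlib

open MeasureTheory
open scoped ContDiff

noncomputable section

/-! ## Points, the half-space, the Dirichlet heat kernel

Throughout `n = d + 1`. A point of `ℝⁿ` is `x = (x̄, xₙ)`: the tangential part `x̄` consists of the
first `d` coordinates and the normal coordinate is the last one. -/

/-- Points of `ℝⁿ`, `n = d + 1`. Euclidean distances are written out below, the sup norm that
Mathlib puts on this type is never used as a distance. -/
abbrev Pt (d : ℕ) : Type := Fin (d + 1) → ℝ

/-- The upper half-space `ℍⁿ = {xₙ > 0}`. -/
def halfSpace (d : ℕ) : Set (Pt d) := {x | 0 < x (Fin.last d)}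

/-- The configuration space `(ℍⁿ)^V`. -/
def halfSpaceConfig (d nV : ℕ) : Set (Fin nV → Pt d) := {x | ∀ v, x v ∈ halfSpace d}

/-- The squared Euclidean distance. -/
def sqDist {d : ℕ} (x y : Pt d) : ℝ := ∑ i, (x i - y i) ^ 2

/-- The sign with which the `i`-th coordinate is multiplied: `b` in the normal direction and `1` in
the tangential directions. -/
def reflSign {d : ℕ} (b : ℤˣ) (i : Fin (d + 1)) : ℝ := if i = Fin.last d then ((b : ℤ) : ℝ) else 1

/-- `reflPt 1 y = y`, and `reflPt (-1) y = y*` is the reflection of `y` in the hyperplane `yₙ = 0`. -/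
def reflPt {d : ℕ} (b : ℤˣ) (y : Pt d) : Pt d := fun i => reflSign b i * y i

/-- The Dirichlet heat kernel of the half-space,
`K_t(x, y) = (4πt)^{-n/2} (exp(-|x - y|²/4t) - exp(-|x - y*|²/4t))`. -/
def dirichletHeatKernel {d : ℕ} (t : ℝ) (x y : Pt d) : ℝ :=
  (4 * Real.pi * t) ^ (-(((d : ℝ) + 1) / 2)) *
    (Real.exp (-(sqDist x y) / (4 * t)) - Real.exp (-(sqDist x (reflPt (-1) y)) / (4 * t)))

/-! ## Multi-indices and derivatives -/

/-- The multi-indices `p : ι → ℕ` with `|p| = ∑ i, p i ≤ N`. -/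
def multiIndices (ι : Type) [Fintype ι] [DecidableEq ι] (N : ℕ) : Finset (ι → ℕ) :=
  (Fintype.piFinset fun _ : ι => Finset.range (N + 1)).filter fun p => ∑ i, p i ≤ N

/-- The partial derivative `∂g/∂xᵢ`. -/
def partialDeriv {d : ℕ} (i : Fin (d + 1)) (g : Pt d → ℝ) : Pt d → ℝ :=
  fun x => fderiv ℝ g x (Pi.single i 1)

/-- The derivative `∂^I g` along a multi-index `I`. -/
def multiDeriv {d : ℕ} (I : Fin (d + 1) → ℕ) (g : Pt d → ℝ) : Pt d → ℝ :=
  (List.finRange (d + 1)).foldr (fun i h => (partialDeriv i)^[I i] h) g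

/-- The mixed derivative `∂_x^I ∂_y^{I'} K_t(x, y)` of the heat kernel. -/
def heatKernelDeriv {d : ℕ} (t : ℝ) (I I' : Fin (d + 1) → ℕ) (x y : Pt d) : ℝ :=
  multiDeriv I (fun x' => multiDeriv I' (fun y' => dirichletHeatKernel t x' y') y) x

/-- The `C^p` norm on the half-space, `max_{j ≤ p} sup_{x ∈ ℍⁿ} ‖D^j α(x)‖`. -/
def CpNorm {d : ℕ} (p : ℕ) (α : Pt d → ℝ) : ℝ :=
  sSup {r | ∃ j ≤ p, ∃ x ∈ halfSpace d, r = ‖iteratedFDeriv ℝ j α x‖}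

/-- The Taylor polynomial of degree `N` of `F` at the origin, evaluated at `y`. -/
def taylorPoly {E : Type} [NormedAddCommGroup E] [NormedSpace ℝ E] (N : ℕ) (F : E → ℝ) (y : E) :
    ℝ :=
  ∑ j ∈ Finset.range (N + 1), ((j.factorial : ℝ))⁻¹ * iteratedFDeriv ℝ j F 0 (fun _ => y)

/-! ## Local functionals and stable graphs -/

/-- A local functional of degree `r` and order at most `order` of a scalar field on the half-space,
`α ↦ ∑ ∫ a^{I¹, …, Iʳ} ∂^{I¹} α ⋯ ∂^{Iʳ} α`, the sum being over `|I¹| + ⋯ + |Iʳ| ≤ order`. The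
coefficients are smooth up to the boundary (that is, restrictions of smooth functions on `ℝⁿ`) and
compactly supported. -/
structure LocalFunctional (d r : ℕ) where
  order : ℕ
  coeff : (Fin r → Fin (d + 1) → ℕ) → Pt d → ℝ
  coeff_smooth : ∀ I, ContDiff ℝ ∞ (coeff I)
  coeff_compact : ∀ I, HasCompactSupport (coeff I)

/-- The coefficients of the symmetrization `S^r I = ∑_σ I^σ`. -/
def LocalFunctional.symCoeff {d r : ℕ} (I : LocalFunctional d r) (J : Fin r → Fin (d + 1) → ℕ)
    (x : Pt d) : ℝ :=
  ∑ σ : Equiv.Perm (Fin r), I.coeff (fun i => J (σ i)) x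

/-- The half-edges of a graph: the first half of each edge, the second half of each edge, and the
tails. -/
abbrev HalfEdge (nE nT : ℕ) : Type := (Fin nE ⊕ Fin nE) ⊕ Fin nT

/-- A stable graph, with its vertices, edges and tails numbered, its edges oriented (`src e` and
`tgt e` are the vertices `v₁(e)` and `v₂(e)`; loops and multiple edges are allowed), and the
half-edges at each vertex `v` put in an order `v¹, …, v^{k(v)}`, where `k(v)` is the valency. -/
structure StableGraph (nV nE nT : ℕ) where
  genus : Fin nV → ℕ
  src : Fin nE → Fin nV
  tgt : Fin nE → Fin nV
  tail : Fin nT → Fin nV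
  valency : Fin nV → ℕ
  halfEdge : ∀ v : Fin nV,
    Fin (valency v) ≃ {h : HalfEdge nE nT // Sum.elim (Sum.elim src tgt) tail h = v}

namespace StableGraph

variable {nV nE nT : ℕ} (γ : StableGraph nV nE nT)

/-- Any two vertices are joined by a path of edges (in either direction) that belong to `F`. -/
def ConnectedBy (F : Finset (Fin nE)) : Prop :=
  ∀ a b : Fin nV, Relation.EqvGen (fun a b => ∃ e ∈ F, γ.src e = a ∧ γ.tgt e = b) a b

/-- `F` is the edge set of a spanning tree: it connects all vertices and `|F| = |V| - 1`. A graph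
has a spanning tree exactly if it is connected (and has a vertex). -/
def IsSpanningTree (F : Finset (Fin nE)) : Prop := γ.ConnectedBy F ∧ F.card + 1 = nV

/-- The order of the local functional `I_{g(v), k(v)}` at the vertex `v`. -/
def vertexOrder {d : ℕ} (I : ∀ i r : ℕ, LocalFunctional d r) (v : Fin nV) : ℕ :=
  (I (γ.genus v) (γ.valency v)).order

/-- `O(γ)`, the sum of the orders of the local functionals at the vertices. -/
def totalOrder {d : ℕ} (I : ∀ i r : ℕ, LocalFunctional d r) : ℕ := ∑ v, γ.vertexOrder I v

/-- The assignments of a multi-index `I^h` to every half-edge `h` such that, at every vertex `v`,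
`|I^{v¹}| + ⋯ + |I^{v^{k(v)}}|` is at most the order of the functional at `v`. -/
def derivAssignments {d : ℕ} (I : ∀ i r : ℕ, LocalFunctional d r) :
    Finset (HalfEdge nE nT → Fin (d + 1) → ℕ) :=
  (Fintype.piFinset fun _ : HalfEdge nE nT => multiIndices (Fin (d + 1)) (γ.totalOrder I)).filter
    fun ι => ∀ v, ∑ i, ∑ c, ι (γ.halfEdge v i).1 c ≤ γ.vertexOrder I v

/-- The factor `∏_v a^{I^{v¹}, …, I^{v^k}}(x_v)`. -/
def vertexFactor {d : ℕ} (I : ∀ i r : ℕ, LocalFunctional d r)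
    (ι : HalfEdge nE nT → Fin (d + 1) → ℕ) (x : Fin nV → Pt d) : ℝ :=
  ∏ v, (I (γ.genus v) (γ.valency v)).symCoeff (fun i => ι (γ.halfEdge v i).1) (x v)

/-- The factor `∏_h ∂^{I^h} α(x_{v(h)})` over the tails. -/
def tailFactor {d : ℕ} (α : Pt d → ℝ) (ι : HalfEdge nE nT → Fin (d + 1) → ℕ)
    (x : Fin nV → Pt d) : ℝ :=
  ∏ h, multiDeriv (ι (Sum.inr h)) α (x (γ.tail h))

/-- The integrand of `f_{γ,I}(t)[α]`: local functionals at the vertices, derivatives of the heat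
kernel on the edges and derivatives of the field `α` on the tails. -/
def weightIntegrand {d : ℕ} (I : ∀ i r : ℕ, LocalFunctional d r) (t : Fin nE → ℝ) (α : Pt d → ℝ)
    (x : Fin nV → Pt d) : ℝ :=
  ∑ ι ∈ γ.derivAssignments I,
    γ.vertexFactor I ι x *
      (∏ e, heatKernelDeriv (t e) (ι (Sum.inl (Sum.inl e))) (ι (Sum.inl (Sum.inr e)))
        (x (γ.src e)) (x (γ.tgt e))) *
      γ.tailFactor α ι x

/-- `f_{γ,I}(t)[α]`, the integral of the integrand above over `(ℍⁿ)^V`. -/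
def weight {d : ℕ} (I : ∀ i r : ℕ, LocalFunctional d r) (t : Fin nE → ℝ) (α : Pt d → ℝ) : ℝ :=
  ∫ x in halfSpaceConfig d nV, γ.weightIntegrand I t α x

end StableGraph

/-! ## The functions `Φ_{J,β}` -/

/-- The polynomial `P_m(s, τ)`, in the outer variable `s` and the inner variable `τ`, for which
`(∂/∂s)^m exp(-s²/4t) = P_m(s, 1/t) exp(-s²/4t)`. -/
def gaussPoly : ℕ → Polynomial (Polynomial ℝ)
  | 0 => 1
  | m + 1 => Polynomial.derivative (gaussPoly m) -
      Polynomial.C (Polynomial.C (1 / 2) * Polynomial.X) * Polynomial.X * gaussPoly m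

/-- The polynomial `P` in `τ = 1/t` for which
`∂_x^I ∂_y^{I'} exp(-|x - y'|²/4t) = P(1/t) exp(-|x - y'|²/4t)`, where `y' = reflPt b y`. -/
def edgePoly {d : ℕ} (b : ℤˣ) (I I' : Fin (d + 1) → ℕ) (x y : Pt d) : Polynomial ℝ :=
  ∏ i, Polynomial.C ((-reflSign b i) ^ I' i) *
    (gaussPoly (I i + I' i)).eval (Polynomial.C (x i - reflPt b y i))

namespace StableGraph

variable {nV nE nT : ℕ} (γ : StableGraph nV nE nT)

/-- `∑_e Q_e^{(β_e)}/4t_e`, where `Q_e^{(1)} = |x_{v₁(e)} - x_{v₂(e)}|²` and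
`Q_e^{(-1)} = |x_{v₁(e)} - x_{v₂(e)}*|²`. -/
def quadForm {d : ℕ} (β : Fin nE → ℤˣ) (t : Fin nE → ℝ) (x : Fin nV → Pt d) : ℝ :=
  ∑ e, sqDist (x (γ.src e)) (reflPt (β e) (x (γ.tgt e))) / (4 * t e)

/-- `Φ_{J,β}` for `J = -j`: after every heat kernel in the integrand of `f_{γ,I}(t)[α]` has been
split into its direct term (`β_e = 1`) and its reflected term (`β_e = -1`), it is the coefficient of
`∏_e t_e^{-j_e - n/2} · exp(-∑_e Q_e^{(β_e)}/4t_e)`. -/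
def Phi {d : ℕ} (I : ∀ i r : ℕ, LocalFunctional d r) (α : Pt d → ℝ) (β : Fin nE → ℤˣ)
    (j : Fin nE → ℕ) (x : Fin nV → Pt d) : ℝ :=
  ∑ ι ∈ γ.derivAssignments I,
    γ.vertexFactor I ι x *
      (∏ e, (4 * Real.pi) ^ (-(((d : ℝ) + 1) / 2)) * (((β e : ℤˣ) : ℤ) : ℝ) *
        (edgePoly (β e) (ι (Sum.inl (Sum.inl e))) (ι (Sum.inl (Sum.inr e)))
          (x (γ.src e)) (x (γ.tgt e))).coeff (j e)) *
      γ.tailFactor α ι x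

/-! ## Coordinates on `(ℝⁿ)^V` -/

/-- The map `x ↦ (y, w)`, `y_e = x_{v₁(e)} - x_{v₂(e)}` for `e ∈ F` and `w = ∑_v x_v`. -/
def treeMap (F : Finset (Fin nE)) : (Fin nV → ℝ) →ₗ[ℝ] (F → ℝ) × ℝ where
  toFun x := (fun e => x (γ.src e) - x (γ.tgt e), ∑ v, x v)
  map_add' x y := by
    ext
    · simp; ring
    · simp [Finset.sum_add_distrib]
  map_smul' c x := by
    ext
    · simp; ring
    · simp [Finset.mul_sum]

theorem treeMap_bijective {F : Finset (Fin nE)} (hF : γ.IsSpanningTree F) :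
    Function.Bijective (γ.treeMap F) := by
  have hinj : Function.Injective (γ.treeMap F) := by
    rw [← LinearMap.ker_eq_bot, LinearMap.ker_eq_bot']
    intro x hx
    have h1 : ∀ e ∈ F, x (γ.src e) = x (γ.tgt e) := fun e he => by
      have := congrFun (congrArg Prod.fst hx) ⟨e, he⟩
      simpa [treeMap, sub_eq_zero] using this
    have h2 : ∑ v, x v = 0 := congrArg Prod.snd hx
    have h3 : ∀ a b, x a = x b := fun a b => by
      induction hF.1 a b with
      | rel a b h => obtain ⟨e, he, rfl, rfl⟩ := h; exact h1 e he
      | refl => rfl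
      | symm _ _ _ ih => exact ih.symm
      | trans _ _ _ _ _ ih ih' => exact ih.trans ih'
    funext a
    rw [Finset.sum_congr rfl fun v _ => h3 v a] at h2
    have : (nV : ℝ) ≠ 0 := by rw [← hF.2]; positivity
    simpa [this] using h2
  refine ⟨hinj, (LinearMap.injective_iff_surjective_of_finrank_eq_finrank ?_).1 hinj⟩
  simp [← hF.2]

/-- Spanning tree coordinates `(y, w)` (of one scalar component) as a linear isomorphism. -/
def treeCoords {F : Finset (Fin nE)} (hF : γ.IsSpanningTree F) :
    (Fin nV → ℝ) ≃ₗ[ℝ] (F → ℝ) × ℝ :=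
  LinearEquiv.ofBijective (γ.treeMap F) (γ.treeMap_bijective hF)

end StableGraph

/-- The map `(z, u) ↦ (u + z₁, u + z₂ - z₁, …, u + z_m - z_{m-1}, u - z_m)`. -/
def normalMap (m : ℕ) : (Fin m → ℝ) × ℝ →ₗ[ℝ] (Fin (m + 1) → ℝ) where
  toFun zu v := zu.2 + ((Fin.snoc zu.1 0 : Fin (m + 1) → ℝ) v - (Fin.cons 0 zu.1 : Fin (m + 1) → ℝ) v)
  map_add' a b := by
    funext v
    have h1 : (Fin.snoc (a + b).1 0 : Fin (m + 1) → ℝ) v =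
        (Fin.snoc a.1 0 : Fin (m + 1) → ℝ) v + (Fin.snoc b.1 0 : Fin (m + 1) → ℝ) v := by
      refine Fin.lastCases ?_ (fun i => ?_) v <;> simp
    have h2 : (Fin.cons 0 (a + b).1 : Fin (m + 1) → ℝ) v =
        (Fin.cons 0 a.1 : Fin (m + 1) → ℝ) v + (Fin.cons 0 b.1 : Fin (m + 1) → ℝ) v := by
      refine Fin.cases ?_ (fun i => ?_) v <;> simp
    rw [Pi.add_apply, h1, h2, Prod.snd_add]
    ring
  map_smul' c a := by
    funext v
    have h1 : (Fin.snoc (c • a).1 0 : Fin (m + 1) → ℝ) v =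
        c * (Fin.snoc a.1 0 : Fin (m + 1) → ℝ) v := by
      refine Fin.lastCases ?_ (fun i => ?_) v <;> simp
    have h2 : (Fin.cons 0 (c • a).1 : Fin (m + 1) → ℝ) v =
        c * (Fin.cons 0 a.1 : Fin (m + 1) → ℝ) v := by
      refine Fin.cases ?_ (fun i => ?_) v <;> simp
    rw [Pi.smul_apply, h1, h2, Prod.smul_snd, smul_eq_mul, smul_eq_mul, RingHom.id_apply]
    ring

theorem normalMap_bijective (m : ℕ) : Function.Bijective (normalMap m) := by
  have hinj : Function.Injective (normalMap m) := by
    rw [← LinearMap.ker_eq_bot, LinearMap.ker_eq_bot']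
    rintro ⟨z, u⟩ h
    have h0 : ∀ v, u + ((Fin.snoc z 0 : Fin (m + 1) → ℝ) v - (Fin.cons 0 z : Fin (m + 1) → ℝ) v) = 0 :=
      fun v => congrFun h v
    have hu : u = 0 := by
      have := Finset.sum_eq_zero fun v (_ : v ∈ Finset.univ) => h0 v
      rw [Finset.sum_add_distrib, Finset.sum_sub_distrib, Fin.sum_univ_castSucc (Fin.snoc z 0),
        Fin.sum_univ_succ (Fin.cons 0 z)] at this
      simp at this
      exact this.resolve_left (by positivity)
    subst hu
    have hz : ∀ (j : ℕ) (hj : j < m), z ⟨j, hj⟩ = 0 := by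
      intro j
      induction j with
      | zero =>
        intro hj
        have := h0 (Fin.castSucc ⟨0, hj⟩)
        rw [Fin.snoc_castSucc] at this
        have e : (Fin.castSucc ⟨0, hj⟩ : Fin (m + 1)) = 0 := rfl
        rw [e, Fin.cons_zero] at this
        simpa using this
      | succ j ih =>
        intro hj
        have := h0 (Fin.castSucc ⟨j + 1, hj⟩)
        rw [Fin.snoc_castSucc] at this
        have e : (Fin.castSucc ⟨j + 1, hj⟩ : Fin (m + 1)) = Fin.succ ⟨j, by omega⟩ := rfl
        rw [e, Fin.cons_succ, ih (by omega)] at this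
        simpa using this
    ext j
    · exact hz j.1 j.2
    · rfl
  refine ⟨hinj, (LinearMap.injective_iff_surjective_of_finrank_eq_finrank ?_).1 hinj⟩
  simp

/-- The coordinates `(z, u)` on `ℝ^{|V|}`, as a linear isomorphism. -/
def normalCoords (m : ℕ) : (Fin (m + 1) → ℝ) ≃ₗ[ℝ] (Fin m → ℝ) × ℝ :=
  (LinearEquiv.ofBijective (normalMap m) (normalMap_bijective m)).symm

namespace StableGraph

variable {m k l : ℕ} (γ : StableGraph (m + 1) (k + 1) l)

/-- The pairs `(ȳ, z)`: a vector `ȳ_e ∈ ℝ^{n-1}` for each edge `e` of the spanning tree, and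
`z ∈ ℝ^{|V|-1}`. -/
abbrev FibreCoords (d m : ℕ) {k : ℕ} (F : Finset (Fin (k + 1))) : Type :=
  (F → Fin d → ℝ) × (Fin m → ℝ)

variable {F : Finset (Fin (k + 1))} (hF : γ.IsSpanningTree F)

/-- The coordinates `(ȳ, z)` of `x`. -/
def fibreCoords {d : ℕ} (x : Fin (m + 1) → Pt d) : FibreCoords d m F :=
  (fun e i => x (γ.src e) i.castSucc - x (γ.tgt e) i.castSucc,
    (normalCoords m fun v => x v (Fin.last d)).1)

/-- The coordinate `w̄` of `x`. -/
def wCoord {d : ℕ} (x : Fin (m + 1) → Pt d) : Fin d → ℝ := fun i => ∑ v, x v i.castSucc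

/-- The coordinate `u` of `x`. -/
def uCoord {d : ℕ} (x : Fin (m + 1) → Pt d) : ℝ := (normalCoords m fun v => x v (Fin.last d)).2

/-- The point `x ∈ (ℝⁿ)^V` with coordinates `(ȳ, w̄, z, u)`. -/
def ofCoords {d : ℕ} (w : Fin d → ℝ) (u : ℝ) (yz : FibreCoords d m F) : Fin (m + 1) → Pt d :=
  fun v => Fin.snoc (α := fun _ => ℝ)
    (fun i => (γ.treeCoords hF).symm (fun e => yz.1 e i, w i) v)
    ((normalCoords m).symm (yz.2, u) v)

/-- `x` is the point with the coordinates of `x`; the next lemma is the converse. -/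
theorem ofCoords_coords {d : ℕ} (x : Fin (m + 1) → Pt d) :
    γ.ofCoords hF (wCoord x) (uCoord x) (γ.fibreCoords x) = x := by
  funext v c
  refine Fin.lastCases ?_ (fun i => ?_) c
  · simp [ofCoords, fibreCoords, uCoord]
  · have : (γ.treeCoords hF) (fun v => x v i.castSucc) =
        (fun e => (γ.fibreCoords (F := F) x).1 e i, wCoord x i) := rfl
    simp [ofCoords, ← this]

theorem coords_ofCoords {d : ℕ} (w : Fin d → ℝ) (u : ℝ) (yz : FibreCoords d m F) :
    wCoord (γ.ofCoords hF w u yz) = w ∧ uCoord (γ.ofCoords hF w u yz) = u ∧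
      γ.fibreCoords (γ.ofCoords hF w u yz) = yz := by
  have h : ∀ i, (γ.treeCoords hF) (fun v => γ.ofCoords hF w u yz v (Fin.castSucc i)) =
      (fun e => yz.1 e i, w i) := fun i => by
    simp only [ofCoords, Fin.snoc_castSucc]
    exact LinearEquiv.apply_symm_apply _ _
  have h' : (normalCoords m) (fun v => γ.ofCoords hF w u yz v (Fin.last d)) = (yz.2, u) := by
    simp only [ofCoords, Fin.snoc_last]
    exact LinearEquiv.apply_symm_apply _ _
  refine ⟨funext fun i => congrArg Prod.snd (h i), congrArg Prod.snd h', Prod.ext ?_ ?_⟩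
  · funext e i
    exact congrFun (congrArg Prod.fst (h i)) e
  · exact congrArg Prod.fst h'

/-- The Taylor polynomial of degree `N` of `Φ` in the variables `(ȳ, z)` at `(ȳ, z) = (0, 0)`, with
`w̄` and `u` held fixed, as a function of `x`. -/
def taylorPhi {d : ℕ} (N : ℕ) (Φ : (Fin (m + 1) → Pt d) → ℝ) (x : Fin (m + 1) → Pt d) : ℝ :=
  taylorPoly N (fun yz : FibreCoords d m F => Φ (γ.ofCoords hF (wCoord x) (uCoord x) yz))
    (γ.fibreCoords x)

/-- The integrand `exp(-∑_e Q_e^{(β_e)}/4t_e) · Φ^N_{J,β}` of a term of `f^N_{γ,I}(t)[α]`, where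
`Φ^N_{J,β}` is the Taylor polynomial of `Φ_{J,β}` and `J = -j`. -/
def taylorIntegrand {d : ℕ} (I : ∀ i r : ℕ, LocalFunctional d r) (N : ℕ) (t : Fin (k + 1) → ℝ)
    (α : Pt d → ℝ) (β : Fin (k + 1) → ℤˣ) (j : Fin (k + 1) → ℕ) (x : Fin (m + 1) → Pt d) : ℝ :=
  Real.exp (-γ.quadForm β t x) * γ.taylorPhi hF N (γ.Phi I α β j) x

/-- `f^N_{γ,I}(t)[α] = ∑_β ∑_J t^{J - n/2} ∫_{(ℍⁿ)^V} exp(-∑_e Q_e^{(β_e)}/4t_e) Φ^N_{J,β}`. The sum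
is over `J = -j` with `-O(γ) ≤ |J| ≤ 0`. -/
def taylorWeight {d : ℕ} (I : ∀ i r : ℕ, LocalFunctional d r) (N : ℕ) (t : Fin (k + 1) → ℝ)
    (α : Pt d → ℝ) : ℝ :=
  ∑ β : Fin (k + 1) → ℤˣ, ∑ j ∈ multiIndices (Fin (k + 1)) (γ.totalOrder I),
    (∏ e, t e ^ (-(j e : ℝ) - ((d : ℝ) + 1) / 2)) *
      ∫ x in halfSpaceConfig d (m + 1), γ.taylorIntegrand hF I N t α β j x

end StableGraph

end

/-! In the code n = d + 1, |V| = m + 1, |E| = k + 1. Write b for the barycentre of a configuration x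
and T for the largest t_e. Fixing (w̄, u) amounts to fixing b, and (ȳ, z) = (0, 0) is the
configuration with all points at b. The Taylor polynomial in (ȳ, z) is therefore that of Φ at (b, …,
b) in the direction x - b, whatever the spanning tree (`taylorPhi_eq`). Its remainder is at most |x
- b|^(N+1) times a bound for the derivative of order N + 1 on the segment from (b, …, b) to x. By
convexity the segment stays in the half-space, where the C^p norms of α control that derivative
(`exists_norm_iteratedFDeriv_Phi_le`).

The Gaussian supplies the power of T. Between points of the half-space the reflected distance is at
least the direct one, and γ is connected, so ∑ Q_e/4t_e ≥ κ|x - b|²/T for every choice of signs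
(`exists_quadForm_ge`). The displacements x - b form a space of dimension (|V| - 1)n, and scaling by
√T turns ∫ |x - b|^(N+1) exp(-κ|x - b|²/T) into a constant times T^((N+1)/2 + (|V|-1)n/2). The
directions of b cost only a constant, because the coefficients of the functionals have compact
support (`exists_integral_gaussBound`).

The prefactors ∏ t_e^(J_e - n/2) have negative exponents, so t_e ≥ T^R bounds them by a power of T;
as T ≤ 1, the worst case |J| = -O(γ) bounds them all (`prod_rpow_le`). It remains to sum over
finitely many β and J. -/

noncomputable section

/-! ## Derivatives of the heat kernel -/

/-- The `m`-th derivative of `s ↦ exp(-s²/4t)`. -/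
def gaussDeriv (t : ℝ) (m : ℕ) (s : ℝ) : ℝ :=
  ((gaussPoly m).eval (Polynomial.C s)).eval (1 / t) * Real.exp (-s ^ 2 / (4 * t))

/-- Evaluating the inner variable at τ is a ring homomorphism, which leaves an ordinary real
polynomial in s. -/
theorem hasDerivAt_eval_eval_C (p : Polynomial (Polynomial ℝ)) (τ s : ℝ) :
    HasDerivAt (fun s : ℝ => (p.eval (Polynomial.C s)).eval τ)
      (((Polynomial.derivative p).eval (Polynomial.C s)).eval τ) s := by
  have key : ∀ (q : Polynomial (Polynomial ℝ)) (s : ℝ),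
      (q.eval (Polynomial.C s)).eval τ = (q.map (Polynomial.evalRingHom τ)).eval s := fun q s => by
    rw [← Polynomial.coe_evalRingHom, ← Polynomial.eval₂_at_apply, Polynomial.eval_map]
    simp
  simp only [key]
  rw [← Polynomial.derivative_map]
  exact Polynomial.hasDerivAt _ _

theorem hasDerivAt_gaussDeriv (t : ℝ) (m : ℕ) (s : ℝ) :
    HasDerivAt (gaussDeriv t m) (gaussDeriv t (m + 1) s) s := by
  have h2 : HasDerivAt (fun s : ℝ => Real.exp (-s ^ 2 / (4 * t)))
      (Real.exp (-s ^ 2 / (4 * t)) * (-(2 * s) / (4 * t))) s := by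
    have h := (((hasDerivAt_pow 2 s).fun_neg).div_const (4 * t)).exp
    simpa using h
  refine ((hasDerivAt_eval_eval_C (gaussPoly m) (1 / t) s).fun_mul h2).congr_deriv ?_
  simp only [gaussDeriv, gaussPoly, Polynomial.eval_sub, Polynomial.eval_mul, Polynomial.eval_C,
    Polynomial.eval_X]
  -- At t = 0, division by zero makes the exponential constantly 1 and kills the second term of the
  -- recursion for `gaussPoly`, so no sign condition on t is needed.
  rcases eq_or_ne t 0 with rfl | ht
  · simp
  · field_simp
    ring

/-- Differentiation of a linear combination of products of functions of one variable. -/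
theorem multiDeriv_sum_prod {d : ℕ} {B : Type*} [Fintype B] (c : B → ℝ)
    (f : B → Fin (d + 1) → ℕ → ℝ → ℝ)
    (hf : ∀ b i k s, HasDerivAt (f b i k) (f b i (k + 1) s) s) (I : Fin (d + 1) → ℕ) :
    multiDeriv I (fun x => ∑ b, c b * ∏ i, f b i 0 (x i)) =
      fun x => ∑ b, c b * ∏ i, f b i (I i) (x i) := by
  -- The shape of the function is stable under differentiation: `f b i k` plays the k-th derivative
  -- of a factor, and ∂_i only raises the order of the i-th factor.
  have step : ∀ (a : Fin (d + 1) → ℕ) (i : Fin (d + 1)),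
      partialDeriv i (fun x => ∑ b, c b * ∏ j, f b j (a j) (x j)) =
        fun x => ∑ b, c b * ∏ j, f b j (a j + if j = i then 1 else 0) (x j) := by
    intro a i
    funext x
    have hd : ∀ b, HasFDerivAt (fun x : Pt d => ∏ j, f b j (a j) (x j))
        (∑ j, (∏ k ∈ Finset.univ.erase j, f b k (a k) (x k)) •
          (f b j (a j + 1) (x j) • ContinuousLinearMap.proj (R := ℝ) (φ := fun _ => ℝ) j)) x := fun b =>
      HasFDerivAt.finsetProd fun j _ =>
        (hf b j (a j) (x j)).comp_hasFDerivAt x (hasFDerivAt_apply j x)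
    have := (HasFDerivAt.fun_sum (u := Finset.univ)
      fun b _ => (hd b).const_mul (c b))
    rw [partialDeriv, this.fderiv]
    simp only [_root_.sum_apply, _root_.smul_apply,
      ContinuousLinearMap.proj_apply, smul_eq_mul]
    refine Finset.sum_congr rfl fun b _ => congrArg _ ?_
    rw [Finset.sum_eq_single i]
    · rw [Pi.single_eq_same, ← Finset.mul_prod_erase _ _ (Finset.mem_univ i)]
      rw [if_pos rfl, mul_one, mul_comm]
      refine congrArg _ (Finset.prod_congr rfl fun k hk => ?_)
      rw [if_neg (Finset.ne_of_mem_erase hk), add_zero]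
    · intro j _ hj
      simp [hj]
    · simp
  have iter : ∀ (n : ℕ) (a : Fin (d + 1) → ℕ) (i : Fin (d + 1)),
      (partialDeriv i)^[n] (fun x => ∑ b, c b * ∏ j, f b j (a j) (x j)) =
        fun x => ∑ b, c b * ∏ j, f b j (a j + if j = i then n else 0) (x j) := by
    intro n a i
    induction n with
    | zero => simp
    | succ n ih =>
      rw [Function.iterate_succ_apply', ih, step]
      refine funext fun x => Finset.sum_congr rfl fun b _ => congrArg _
        (Finset.prod_congr rfl fun j _ => ?_)
      split_ifs <;> rfl
  -- Without repetitions in the list, each coordinate is differentiated in exactly one pass of the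
  -- fold, so orders are either 0 or final.
  have fold : ∀ l : List (Fin (d + 1)), l.Nodup →
      l.foldr (fun i h => (partialDeriv i)^[I i] h)
        (fun x => ∑ b, c b * ∏ j, f b j 0 (x j)) =
        fun x => ∑ b, c b * ∏ j, f b j (if j ∈ l then I j else 0) (x j) := by
    intro l hl
    induction l with
    | nil => simp
    | cons i l ih =>
      rw [List.nodup_cons] at hl
      rw [List.foldr_cons, ih hl.2, iter]
      refine funext fun x => Finset.sum_congr rfl fun b _ => congrArg _
        (Finset.prod_congr rfl fun j _ => ?_)
      by_cases hj : j = i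
      · subst hj; simp [hl.1]
      · simp [hj]
  rw [multiDeriv, fold _ (List.nodup_finRange _)]
  simp

theorem exp_neg_sqDist {d : ℕ} (t : ℝ) (b : ℤˣ) (x y : Pt d) :
    Real.exp (-(sqDist x (reflPt b y)) / (4 * t)) =
      ∏ i, gaussDeriv t 0 (x i - reflSign b i * y i) := by
  simp only [gaussDeriv, gaussPoly, Polynomial.eval_one, one_mul, ← Real.exp_sum, sqDist, reflPt]
  rw [← Finset.sum_div, Finset.sum_neg_distrib]

/-- The direct and reflected terms are indexed by the units ±1, which also serve as their
coefficients; this is the form to which `multiDeriv_sum_prod` applies. -/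
theorem dirichletHeatKernel_eq_sum {d : ℕ} (t : ℝ) (x y : Pt d) :
    dirichletHeatKernel t x y = ∑ b : ℤˣ,
      ((4 * Real.pi * t) ^ (-(((d : ℝ) + 1) / 2)) * ((b : ℤ) : ℝ)) *
        ∏ i, gaussDeriv t 0 (x i - reflSign b i * y i) := by
  simp only [← exp_neg_sqDist]
  have h1 : reflPt 1 y = y := by funext i; simp [reflPt, reflSign]
  rw [Fintype.sum_eq_add (1 : ℤˣ) (-1) (by decide)
    (fun b hb => absurd (Int.units_eq_one_or b) (by tauto)), h1, dirichletHeatKernel]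
  push_cast
  ring

/-- Each factor depends on x_i - (±y_i) only. Every y-derivative brings out `-reflSign b i` by the
chain rule, and the orders in x and y add up. -/
theorem heatKernelDeriv_eq_sum {d : ℕ} (t : ℝ) (I I' : Fin (d + 1) → ℕ) (x y : Pt d) :
    heatKernelDeriv t I I' x y = ∑ b : ℤˣ,
      ((4 * Real.pi * t) ^ (-(((d : ℝ) + 1) / 2)) * ((b : ℤ) : ℝ)) *
        ((edgePoly b I I' x y).eval (1 / t) *
          Real.exp (-(sqDist x (reflPt b y)) / (4 * t))) := by
  have inner : ∀ x' : Pt d, multiDeriv I' (fun y' => dirichletHeatKernel t x' y') y =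
      ∑ b : ℤˣ, ((4 * Real.pi * t) ^ (-(((d : ℝ) + 1) / 2)) * ((b : ℤ) : ℝ) *
        ∏ i, (-reflSign b i) ^ I' i) *
        ∏ i, gaussDeriv t (0 + I' i) (x' i - reflSign b i * y i) := by
    intro x'
    simp only [dirichletHeatKernel_eq_sum]
    have := congrFun (multiDeriv_sum_prod
      (fun b : ℤˣ => (4 * Real.pi * t) ^ (-(((d : ℝ) + 1) / 2)) * ((b : ℤ) : ℝ))
      (fun b i k s => (-reflSign b i) ^ k * gaussDeriv t k (x' i - reflSign b i * s))
      (fun b i k s => by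
        have h1 : HasDerivAt (fun s => x' i - reflSign b i * s) (-reflSign b i) s := by
          simpa using ((hasDerivAt_id s).const_mul (reflSign b i)).const_sub (x' i)
        refine (((hasDerivAt_gaussDeriv t k _).comp s h1).const_mul
          ((-reflSign b i) ^ k)).congr_deriv ?_
        rw [pow_succ]; ring) I') y
    simp only [pow_zero, one_mul] at this
    rw [this]
    simp only [Finset.prod_mul_distrib, zero_add, mul_assoc]
  rw [heatKernelDeriv]
  simp only [inner]
  have := congrFun (multiDeriv_sum_prod
    (fun b : ℤˣ => (4 * Real.pi * t) ^ (-(((d : ℝ) + 1) / 2)) * ((b : ℤ) : ℝ) *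
        ∏ i, (-reflSign b i) ^ I' i)
    (fun b i k s => gaussDeriv t (k + I' i) (s - reflSign b i * y i))
    (fun b i k s => by
      have h := (hasDerivAt_gaussDeriv t (k + I' i) (s - reflSign b i * y i)).comp s
        ((hasDerivAt_id s).sub_const (reflSign b i * y i))
      rw [mul_one, add_right_comm] at h
      exact h) I) x
  rw [this]
  refine Finset.sum_congr rfl fun b _ => ?_
  rw [mul_assoc, exp_neg_sqDist, edgePoly, Polynomial.eval_prod, ← Finset.prod_mul_distrib,
    ← Finset.prod_mul_distrib]
  refine congrArg _ (Finset.prod_congr rfl fun i _ => ?_)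
  simp only [gaussDeriv, gaussPoly, Polynomial.eval_mul, Polynomial.eval_C, Polynomial.eval_one,
    reflPt]
  ring

/-! ## Expansion in powers of the edge parameters -/

/-- Each derivative of the Gaussian produces at most one new factor 1/t. This is the source of the
restriction -O(γ) ≤ |J|. -/
theorem natDegree_coeff_gaussPoly_le (m i : ℕ) : ((gaussPoly m).coeff i).natDegree ≤ m := by
  induction m generalizing i with
  | zero =>
    rw [gaussPoly, Polynomial.coeff_one]
    split_ifs <;> simp
  | succ m ih =>
    rw [gaussPoly, Polynomial.coeff_sub]
    refine (Polynomial.natDegree_sub_le _ _).trans (max_le ?_ ?_)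
    · rw [Polynomial.coeff_derivative]
      refine Polynomial.natDegree_mul_le.trans ?_
      have h : ((i : Polynomial ℝ) + 1).natDegree = 0 := by
        exact_mod_cast Polynomial.natDegree_natCast (R := ℝ) (i + 1)
      rw [h]
      exact (ih _).trans (Nat.le_succ m)
    · rw [mul_assoc, Polynomial.coeff_C_mul]
      refine Polynomial.natDegree_mul_le.trans ?_
      have h1 : (Polynomial.C (1 / 2 : ℝ) * Polynomial.X).natDegree ≤ 1 :=
        (Polynomial.natDegree_C_mul_le _ _).trans Polynomial.natDegree_X_le
      have h2 : ((Polynomial.X * gaussPoly m).coeff i).natDegree ≤ m := by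
        cases i with
        | zero => simp
        | succ i => rw [Polynomial.coeff_X_mul]; exact ih i
      omega

theorem natDegree_eval_gaussPoly_le (m : ℕ) (s : ℝ) :
    ((gaussPoly m).eval (Polynomial.C s)).natDegree ≤ m := by
  rw [Polynomial.eval_eq_sum, Polynomial.sum]
  refine Polynomial.natDegree_sum_le_of_forall_le _ _ fun _ _ => ?_
  rw [← Polynomial.C_pow]
  exact (Polynomial.natDegree_mul_C_le _ _).trans (natDegree_coeff_gaussPoly_le m _)

theorem natDegree_edgePoly_le {d : ℕ} (b : ℤˣ) (I I' : Fin (d + 1) → ℕ) (x y : Pt d) :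
    (edgePoly b I I' x y).natDegree ≤ ∑ i, I i + ∑ i, I' i := by
  rw [edgePoly, ← Finset.sum_add_distrib]
  refine (Polynomial.natDegree_prod_le _ _).trans (Finset.sum_le_sum fun i _ => ?_)
  exact (Polynomial.natDegree_C_mul_le _ _).trans (natDegree_eval_gaussPoly_le _ _)

namespace StableGraph

variable {nV nE nT : ℕ} (γ : StableGraph nV nE nT)

/-- Every half-edge sits at exactly one vertex, so the bounds at the vertices add up to a bound over
all half-edges, here sorted into edges and tails. -/
theorem sum_derivAssignments_le {d : ℕ} (I : ∀ i r : ℕ, LocalFunctional d r)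
    {ι : HalfEdge nE nT → Fin (d + 1) → ℕ} (hι : ι ∈ γ.derivAssignments I) :
    ∑ e, (∑ c, ι (Sum.inl (Sum.inl e)) c + ∑ c, ι (Sum.inl (Sum.inr e)) c) +
      ∑ h, ∑ c, ι (Sum.inr h) c ≤ γ.totalOrder I := by
  have h1 : ∑ v, ∑ i, ∑ c, ι (γ.halfEdge v i).1 c = ∑ h, ∑ c, ι h c := by
    rw [← Fintype.sum_fiberwise (Sum.elim (Sum.elim γ.src γ.tgt) γ.tail)]
    exact Finset.sum_congr rfl fun v _ => (γ.halfEdge v).sum_comp fun h => ∑ c, ι h.1 c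
  have h2 : ∑ h, ∑ c, ι h c ≤ γ.totalOrder I :=
    h1 ▸ Finset.sum_le_sum fun v _ => (Finset.mem_filter.1 hι).2 v
  simpa [Fintype.sum_sum_type, Finset.sum_add_distrib] using h2

theorem exp_neg_quadForm {d : ℕ} (β : Fin nE → ℤˣ) (t : Fin nE → ℝ) (x : Fin nV → Pt d) :
    Real.exp (-γ.quadForm β t x) =
      ∏ e, Real.exp (-(sqDist (x (γ.src e)) (reflPt (β e) (x (γ.tgt e)))) / (4 * t e)) := by
  rw [← Real.exp_sum, quadForm]
  simp only [neg_div, Finset.sum_neg_distrib]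

/-- The product of the derivatives of the heat kernels, expanded in powers of the `t_e`. -/
theorem prod_heatKernelDeriv {d : ℕ} (I : ∀ i r : ℕ, LocalFunctional d r) {t : Fin nE → ℝ}
    (ht : ∀ e, 0 < t e) {ι : HalfEdge nE nT → Fin (d + 1) → ℕ} (hι : ι ∈ γ.derivAssignments I)
    (x : Fin nV → Pt d) :
    (∏ e, heatKernelDeriv (t e) (ι (Sum.inl (Sum.inl e))) (ι (Sum.inl (Sum.inr e)))
        (x (γ.src e)) (x (γ.tgt e))) =
      ∑ β : Fin nE → ℤˣ, ∑ j ∈ multiIndices (Fin nE) (γ.totalOrder I),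
        (∏ e, t e ^ (-(j e : ℝ) - ((d : ℝ) + 1) / 2)) * (Real.exp (-γ.quadForm β t x) *
          ∏ e, (4 * Real.pi) ^ (-(((d : ℝ) + 1) / 2)) * (((β e : ℤˣ) : ℤ) : ℝ) *
            (edgePoly (β e) (ι (Sum.inl (Sum.inl e))) (ι (Sum.inl (Sum.inr e)))
              (x (γ.src e)) (x (γ.tgt e))).coeff (j e)) := by
  simp only [heatKernelDeriv_eq_sum]
  rw [Finset.prod_univ_sum, Fintype.piFinset_univ]
  refine Finset.sum_congr rfl fun β _ => ?_
  set P : Fin nE → Polynomial ℝ := fun e => edgePoly (β e) (ι (Sum.inl (Sum.inl e)))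
    (ι (Sum.inl (Sum.inr e))) (x (γ.src e)) (x (γ.tgt e)) with hP
  have hdeg : ∀ e, (P e).natDegree ≤
      ∑ c, ι (Sum.inl (Sum.inl e)) c + ∑ c, ι (Sum.inl (Sum.inr e)) c :=
    fun e => natDegree_edgePoly_le _ _ _ _ _
  have hsum : ∑ e, (P e).natDegree ≤ γ.totalOrder I :=
    (Finset.sum_le_sum fun e _ => hdeg e).trans
      ((Nat.le_add_right _ _).trans (γ.sum_derivAssignments_le I hι))
  -- All edge polynomials are expanded up to the common degree O(γ), so that the product of the sums
  -- becomes one sum over functions j.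
  have hfac : ∀ e, (4 * Real.pi * t e) ^ (-(((d : ℝ) + 1) / 2)) * (((β e : ℤˣ) : ℤ) : ℝ) *
      ((P e).eval (1 / t e) *
        Real.exp (-(sqDist (x (γ.src e)) (reflPt (β e) (x (γ.tgt e)))) / (4 * t e))) =
      Real.exp (-(sqDist (x (γ.src e)) (reflPt (β e) (x (γ.tgt e)))) / (4 * t e)) *
        ∑ i ∈ Finset.range (γ.totalOrder I + 1), t e ^ (-(i : ℝ) - ((d : ℝ) + 1) / 2) *
          ((4 * Real.pi) ^ (-(((d : ℝ) + 1) / 2)) * (((β e : ℤˣ) : ℤ) : ℝ) * (P e).coeff i) := by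
    intro e
    have h1 : (P e).natDegree < γ.totalOrder I + 1 :=
      Nat.lt_succ_of_le ((Finset.single_le_sum (f := fun e => (P e).natDegree)
        (fun _ _ => Nat.zero_le _) (Finset.mem_univ e)).trans hsum)
    rw [Polynomial.eval_eq_sum_range' h1, Real.mul_rpow (by positivity) (ht e).le, Finset.mul_sum,
      Finset.sum_mul, Finset.mul_sum]
    refine Finset.sum_congr rfl fun i _ => ?_
    rw [sub_eq_add_neg, Real.rpow_add (ht e), Real.rpow_neg (ht e).le (i : ℝ), Real.rpow_natCast,
      one_div, inv_pow]
    ring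
  refine (Finset.prod_congr rfl fun e _ => hfac e).trans ?_
  rw [Finset.prod_mul_distrib, ← exp_neg_quadForm, Finset.prod_univ_sum, multiIndices,
    Finset.mul_sum, Finset.sum_filter]
  refine Finset.sum_congr rfl fun j _ => ?_
  split_ifs with hj
  · rw [Finset.prod_mul_distrib]; ring
  -- If |j| > O(γ), some j_e exceeds the degree of its edge polynomial and the term vanishes.
  · obtain ⟨e, -, he⟩ := Finset.exists_lt_of_sum_lt (hsum.trans_lt (not_le.1 hj))
    rw [Finset.prod_eq_zero (Finset.mem_univ e), mul_zero]
    rw [Polynomial.coeff_eq_zero_of_natDegree_lt he, mul_zero, mul_zero]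

theorem weightIntegrand_eq_sum {d : ℕ} (I : ∀ i r : ℕ, LocalFunctional d r) {t : Fin nE → ℝ}
    (ht : ∀ e, 0 < t e) (α : Pt d → ℝ) (x : Fin nV → Pt d) :
    γ.weightIntegrand I t α x =
      ∑ β : Fin nE → ℤˣ, ∑ j ∈ multiIndices (Fin nE) (γ.totalOrder I),
        (∏ e, t e ^ (-(j e : ℝ) - ((d : ℝ) + 1) / 2)) *
          (Real.exp (-γ.quadForm β t x) * γ.Phi I α β j x) := by
  rw [weightIntegrand]
  simp only [Phi, Finset.mul_sum]
  rw [Finset.sum_congr rfl fun β _ => Finset.sum_comm, Finset.sum_comm]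
  refine Finset.sum_congr rfl fun ι hι => ?_
  rw [γ.prod_heatKernelDeriv I ht hι, Finset.mul_sum, Finset.sum_mul]
  refine Finset.sum_congr rfl fun β _ => ?_
  rw [Finset.mul_sum, Finset.sum_mul]
  refine Finset.sum_congr rfl fun j _ => ?_
  ring

end StableGraph

/-! ## Smoothness, supports and derivative bounds -/

theorem contDiff_partialDeriv {d : ℕ} (i : Fin (d + 1)) {g : Pt d → ℝ} (hg : ContDiff ℝ ∞ g) :
    ContDiff ℝ ∞ (partialDeriv i g) :=
  (hg.fderiv_right (m := ∞) le_rfl).clm_apply contDiff_const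

theorem norm_iteratedFDeriv_partialDeriv_le {d : ℕ} (i : Fin (d + 1)) {g : Pt d → ℝ}
    (hg : ContDiff ℝ ∞ g) (q : ℕ) (x : Pt d) :
    ‖iteratedFDeriv ℝ q (partialDeriv i g) x‖ ≤ ‖iteratedFDeriv ℝ (q + 1) g x‖ := by
  set L : (Pt d →L[ℝ] ℝ) →L[ℝ] ℝ := ContinuousLinearMap.apply ℝ ℝ (Pi.single i 1)
  have hL : ‖L‖ ≤ 1 := by
    refine L.opNorm_le_bound zero_le_one fun A => ?_
    refine (A.le_opNorm _).trans ?_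
    rw [Pi.norm_single, norm_one, mul_one, one_mul]
  have hd : ContDiff ℝ ∞ (fderiv ℝ g) := hg.fderiv_right (m := ∞) le_rfl
  have h := L.norm_iteratedFDeriv_comp_left (f := fderiv ℝ g) (x := x) (n := q) (N := ∞)
    hd.contDiffAt (by exact_mod_cast le_top)
  rw [← norm_iteratedFDeriv_fderiv]
  exact h.trans (mul_le_of_le_one_left (norm_nonneg _) hL)

/-- A partial derivative is the Fréchet derivative evaluated at a vector of sup norm 1, so it costs
one order of differentiation and no constant. -/
theorem multiDeriv_smooth_and_bound {d : ℕ} (I : Fin (d + 1) → ℕ) {g : Pt d → ℝ}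
    (hg : ContDiff ℝ ∞ g) :
    ContDiff ℝ ∞ (multiDeriv I g) ∧ ∀ (q : ℕ) (x : Pt d),
      ‖iteratedFDeriv ℝ q (multiDeriv I g) x‖ ≤ ‖iteratedFDeriv ℝ (q + ∑ c, I c) g x‖ := by
  have iter : ∀ (n : ℕ) (i : Fin (d + 1)) (h : Pt d → ℝ), ContDiff ℝ ∞ h →
      ContDiff ℝ ∞ ((partialDeriv i)^[n] h) ∧ ∀ (q : ℕ) (x : Pt d),
        ‖iteratedFDeriv ℝ q ((partialDeriv i)^[n] h) x‖ ≤ ‖iteratedFDeriv ℝ (q + n) h x‖ := by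
    intro n i h hh
    induction n with
    | zero => exact ⟨hh, fun _ _ => le_rfl⟩
    | succ n ih =>
      rw [Function.iterate_succ_apply']
      refine ⟨contDiff_partialDeriv i ih.1, fun q x => ?_⟩
      refine (norm_iteratedFDeriv_partialDeriv_le i ih.1 q x).trans ((ih.2 _ _).trans_eq ?_)
      rw [add_right_comm, add_assoc]
  have fold : ∀ l : List (Fin (d + 1)),
      ContDiff ℝ ∞ (l.foldr (fun i h => (partialDeriv i)^[I i] h) g) ∧ ∀ (q : ℕ) (x : Pt d),
        ‖iteratedFDeriv ℝ q (l.foldr (fun i h => (partialDeriv i)^[I i] h) g) x‖ ≤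
          ‖iteratedFDeriv ℝ (q + (l.map I).sum) g x‖ := by
    intro l
    induction l with
    | nil => exact ⟨hg, fun _ _ => le_rfl⟩
    | cons i l ih =>
      rw [List.foldr_cons]
      refine ⟨(iter _ i _ ih.1).1, fun q x => ((iter _ i _ ih.1).2 q x).trans ?_⟩
      refine (ih.2 _ _).trans_eq ?_
      rw [List.map_cons, List.sum_cons, add_assoc]
  have h := fold (List.finRange (d + 1))
  rw [← List.ofFn_eq_map, List.sum_ofFn] at h
  exact h

theorem CpNorm_nonneg {d : ℕ} (p : ℕ) (α : Pt d → ℝ) : 0 ≤ CpNorm p α :=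
  Real.sSup_nonneg fun _ ⟨_, _, _, _, h⟩ => h ▸ norm_nonneg _

/-- Compact support makes the set in `CpNorm` bounded above; for an unbounded set `sSup` would be 0
and the bound could fail. -/
theorem norm_iteratedFDeriv_le_CpNorm {d : ℕ} {α : Pt d → ℝ} (hα : ContDiff ℝ ∞ α)
    (hc : HasCompactSupport α) {j p : ℕ} (hj : j ≤ p) {x : Pt d} (hx : x ∈ halfSpace d) :
    ‖iteratedFDeriv ℝ j α x‖ ≤ CpNorm p α := by
  refine le_csSup ?_ ⟨j, hj, x, hx, rfl⟩
  have : ∀ i : ℕ, ∃ M, ∀ x, ‖iteratedFDeriv ℝ i α x‖ ≤ M := fun i =>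
    (hα.continuous_iteratedFDeriv (by exact_mod_cast le_top)).bounded_above_of_compact_support
      (hc.iteratedFDeriv i)
  choose M hM using this
  refine ⟨∑ i ∈ Finset.range (p + 1), M i, ?_⟩
  rintro r ⟨i, hi, y, -, rfl⟩
  exact (hM i y).trans (Finset.single_le_sum (f := M)
    (fun i _ => (norm_nonneg _).trans (hM i 0)) (Finset.mem_range.2 (Nat.lt_succ_of_le hi)))

/-- Polynomials that depend smoothly on a parameter. -/
def SmoothCoeffs {X : Type*} [NormedAddCommGroup X] [NormedSpace ℝ X]
    (P : X → Polynomial ℝ) : Prop :=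
  ∀ j, ContDiff ℝ ∞ fun x => (P x).coeff j

namespace SmoothCoeffs

variable {X : Type*} [NormedAddCommGroup X] [NormedSpace ℝ X]

theorem const (p : Polynomial ℝ) : SmoothCoeffs fun _ : X => p := fun _ => contDiff_const

theorem mul {P Q : X → Polynomial ℝ} (hP : SmoothCoeffs P) (hQ : SmoothCoeffs Q) :
    SmoothCoeffs fun x => P x * Q x := fun j => by
  simp only [Polynomial.coeff_mul]
  exact ContDiff.sum fun i _ => (hP _).mul (hQ _)

theorem sum {ι : Type*} {s : Finset ι} {P : ι → X → Polynomial ℝ}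
    (hP : ∀ i, SmoothCoeffs (P i)) : SmoothCoeffs fun x => ∑ i ∈ s, P i x := fun j => by
  simp only [Polynomial.finsetSum_coeff]
  exact ContDiff.sum fun i _ => hP i j

theorem prod {ι : Type*} {s : Finset ι} {P : ι → X → Polynomial ℝ}
    (hP : ∀ i, SmoothCoeffs (P i)) : SmoothCoeffs fun x => ∏ i ∈ s, P i x := by
  classical
  induction s using Finset.induction_on with
  | empty => simpa using const 1
  | insert i s hi ih =>
    simp only [Finset.prod_insert hi]
    exact (hP i).mul ih

theorem eval_C (p : Polynomial (Polynomial ℝ)) {f : X → ℝ} (hf : ContDiff ℝ ∞ f) :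
    SmoothCoeffs fun x => p.eval (Polynomial.C (f x)) := by
  simp only [Polynomial.eval_eq_sum, Polynomial.sum]
  refine sum fun i => (const _).mul fun j => ?_
  simp only [← Polynomial.C_pow, Polynomial.coeff_C]
  split_ifs
  · exact hf.pow i
  · exact contDiff_const

end SmoothCoeffs

theorem smoothCoeffs_edgePoly {d nV : ℕ} (b : ℤˣ) (I I' : Fin (d + 1) → ℕ) (v w : Fin nV) :
    SmoothCoeffs fun x : Fin nV → Pt d => edgePoly b I I' (x v) (x w) := by
  refine SmoothCoeffs.prod fun i => (SmoothCoeffs.const _).mul (SmoothCoeffs.eval_C _ ?_)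
  unfold reflPt
  fun_prop

theorem LocalFunctional.contDiff_symCoeff {d r : ℕ} (I : LocalFunctional d r)
    (J : Fin r → Fin (d + 1) → ℕ) : ContDiff ℝ ∞ (I.symCoeff J) :=
  ContDiff.sum fun _ _ => I.coeff_smooth _

/-! ### Supports and derivatives of the functions Φ -/

namespace StableGraph

variable {nV nE nT : ℕ} (γ : StableGraph nV nE nT)

/-- The part of a summand of `Φ_{J,β}` that does not depend on the field. -/
def backgroundFactor {d : ℕ} (I : ∀ i r : ℕ, LocalFunctional d r) (β : Fin nE → ℤˣ)
    (j : Fin nE → ℕ) (ι : HalfEdge nE nT → Fin (d + 1) → ℕ) (x : Fin nV → Pt d) : ℝ :=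
  γ.vertexFactor I ι x *
      (∏ e, (4 * Real.pi) ^ (-(((d : ℝ) + 1) / 2)) * (((β e : ℤˣ) : ℤ) : ℝ) *
        (edgePoly (β e) (ι (Sum.inl (Sum.inl e))) (ι (Sum.inl (Sum.inr e)))
          (x (γ.src e)) (x (γ.tgt e))).coeff (j e))

variable {d : ℕ} (I : ∀ i r : ℕ, LocalFunctional d r)

theorem contDiff_backgroundFactor (β : Fin nE → ℤˣ) (j : Fin nE → ℕ)
    (ι : HalfEdge nE nT → Fin (d + 1) → ℕ) : ContDiff ℝ ∞ (γ.backgroundFactor I β j ι) := by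
  refine ContDiff.mul (contDiff_prod fun v _ => ?_) (contDiff_prod fun e _ => ?_)
  · exact (LocalFunctional.contDiff_symCoeff _ _).comp (contDiff_apply ℝ (Pt d) v)
  · exact contDiff_const.mul (smoothCoeffs_edgePoly _ _ _ _ _ _)

theorem contDiff_tailFactor {α : Pt d → ℝ} (hα : ContDiff ℝ ∞ α)
    (ι : HalfEdge nE nT → Fin (d + 1) → ℕ) :
    ContDiff ℝ ∞ (γ.tailFactor (nV := nV) α ι) :=
  contDiff_prod fun _ _ => (multiDeriv_smooth_and_bound _ hα).1.comp (contDiff_apply ℝ (Pt d) _)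

theorem contDiff_Phi {α : Pt d → ℝ} (hα : ContDiff ℝ ∞ α) (β : Fin nE → ℤˣ) (j : Fin nE → ℕ) :
    ContDiff ℝ ∞ (γ.Phi I α β j) :=
  ContDiff.sum fun ι _ => (γ.contDiff_backgroundFactor I β j ι).mul (γ.contDiff_tailFactor hα ι)

/-- Every vertex carries a compactly supported coefficient, and only finitely many coefficients
occur. The radius does not involve the field α. -/
theorem exists_support_radius : ∃ r : ℝ, 0 ≤ r ∧ ∀ ι ∈ γ.derivAssignments I,
    ∀ x : Fin nV → Pt d, γ.vertexFactor I ι x ≠ 0 → ‖x‖ ≤ r := by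
  have hK : IsCompact (⋃ ι ∈ γ.derivAssignments I, ⋃ v : Fin nV,
      ⋃ σ : Equiv.Perm (Fin (γ.valency v)),
        tsupport ((I (γ.genus v) (γ.valency v)).coeff fun i => ι (γ.halfEdge v (σ i)).1)) :=
    Finset.isCompact_biUnion _ fun ι _ => isCompact_iUnion fun v => isCompact_iUnion fun σ =>
      (I (γ.genus v) (γ.valency v)).coeff_compact _
  obtain ⟨r, hr0, hr⟩ := hK.isBounded.subset_closedBall_lt 0 0
  refine ⟨r, hr0.le, fun ι hι x hx => (pi_norm_le_iff_of_nonneg hr0.le).2 fun v => ?_⟩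
  have hv := Finset.prod_ne_zero_iff.1 hx v (Finset.mem_univ v)
  obtain ⟨σ, -, hσ⟩ := Finset.exists_ne_zero_of_sum_ne_zero hv
  refine mem_closedBall_zero_iff.1 (hr ?_)
  simp only [Set.mem_iUnion]
  exact ⟨ι, hι, v, σ, subset_tsupport _ hσ⟩

/-- By the Leibniz rule the q derivatives are distributed over the tails, and tail h already carries
|I^h| of them. The total is at most O(γ) + q, so each product of norms is one summand of the
nonnegative sum on the right. -/
theorem norm_iteratedFDeriv_tailFactor_le {α : Pt d → ℝ} (hα : ContDiff ℝ ∞ α)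
    (hc : HasCompactSupport α) {ι : HalfEdge nE nT → Fin (d + 1) → ℕ}
    (hι : ι ∈ γ.derivAssignments I) {q M : ℕ} (hq : q ≤ M) {x : Fin nV → Pt d}
    (hx : x ∈ halfSpaceConfig d nV) :
    ‖iteratedFDeriv ℝ q (γ.tailFactor α ι) x‖ ≤
      (∑ p ∈ (Finset.univ : Finset (Fin nT)).sym q, ((p : Multiset (Fin nT)).countPerms : ℝ)) *
        ∑ p ∈ multiIndices (Fin nT) (γ.totalOrder I + M), ∏ h, CpNorm (p h) α := by
  have hs : ∀ h : Fin nT, ContDiff ℝ ∞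
      fun x : Fin nV → Pt d => multiDeriv (ι (Sum.inr h)) α (x (γ.tail h)) := fun _ =>
    (multiDeriv_smooth_and_bound _ hα).1.comp (contDiff_apply ℝ (Pt d) _)
  refine (norm_iteratedFDeriv_prod_le (N := ∞) (fun h _ => hs h)
    (by exact_mod_cast le_top)).trans ?_
  rw [Finset.sum_mul]
  refine Finset.sum_le_sum fun p hp => mul_le_mul_of_nonneg_left ?_ (Nat.cast_nonneg _)
  set P : Fin nT → ℕ := fun h => (p : Multiset (Fin nT)).count h + ∑ c, ι (Sum.inr h) c with hP
  have hfac : ∀ h : Fin nT, ‖iteratedFDeriv ℝ ((p : Multiset (Fin nT)).count h)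
      (fun x : Fin nV → Pt d => multiDeriv (ι (Sum.inr h)) α (x (γ.tail h))) x‖ ≤
        CpNorm (P h) α := by
    intro h
    set π : (Fin nV → Pt d) →L[ℝ] Pt d :=
      ContinuousLinearMap.proj (R := ℝ) (φ := fun _ => Pt d) (γ.tail h)
    have hπ : ‖π‖ ≤ 1 := by
      refine π.opNorm_le_bound zero_le_one fun y => ?_
      rw [one_mul]; exact norm_le_pi_norm y _
    have hD := multiDeriv_smooth_and_bound (ι (Sum.inr h)) hα
    have h1 := π.iteratedFDeriv_comp_right (hD.1) x
      (i := (p : Multiset (Fin nT)).count h) (by exact_mod_cast le_top)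
    have h2 : (fun x : Fin nV → Pt d => multiDeriv (ι (Sum.inr h)) α (x (γ.tail h))) =
      multiDeriv (ι (Sum.inr h)) α ∘ π := rfl
    rw [h2, h1]
    refine (ContinuousMultilinearMap.norm_compContinuousLinearMap_le _ _).trans ?_
    refine (mul_le_of_le_one_right (norm_nonneg _)
      (Finset.prod_le_one (fun _ _ => norm_nonneg _) fun _ _ => hπ)).trans ?_
    exact (hD.2 _ _).trans (norm_iteratedFDeriv_le_CpNorm hα hc le_rfl (hx _))
  refine (Finset.prod_le_prod (fun _ _ => norm_nonneg _) fun h _ => hfac h).trans ?_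
  refine Finset.single_le_sum (f := fun p : Fin nT → ℕ => ∏ h, CpNorm (p h) α)
    (fun p _ => Finset.prod_nonneg fun h _ => CpNorm_nonneg _ _) ?_
  have hsum : ∑ h, P h ≤ γ.totalOrder I + M := by
    have h1 : ∑ h, (p : Multiset (Fin nT)).count h = q := by
      rw [Multiset.sum_count_eq_card (fun a _ => Finset.mem_univ a)]; exact p.2
    have h2 := γ.sum_derivAssignments_le I hι
    rw [hP, Finset.sum_add_distrib, h1]
    omega
  refine Finset.mem_filter.2 ⟨Fintype.mem_piFinset.2 fun h => Finset.mem_range.2 ?_, hsum⟩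
  exact Nat.lt_succ_of_le ((Finset.single_le_sum (f := P) (fun _ _ => Nat.zero_le _)
    (Finset.mem_univ h)).trans hsum)

theorem hasCompactSupport_backgroundFactor {ι : HalfEdge nE nT → Fin (d + 1) → ℕ}
    (hι : ι ∈ γ.derivAssignments I) (β : Fin nE → ℤˣ) (j : Fin nE → ℕ) :
    HasCompactSupport (γ.backgroundFactor I β j ι) := by
  obtain ⟨r, -, hr⟩ := γ.exists_support_radius I
  refine HasCompactSupport.intro (isCompact_closedBall 0 r) fun x hx => ?_
  by_contra h
  exact hx (mem_closedBall_zero_iff.2 (hr ι hι x (left_ne_zero_of_mul h)))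

theorem exists_vertexFactor_of_Phi_ne_zero {α : Pt d → ℝ} {β : Fin nE → ℤˣ} {j : Fin nE → ℕ}
    {x : Fin nV → Pt d} (hx : γ.Phi I α β j x ≠ 0) :
    ∃ ι ∈ γ.derivAssignments I, γ.vertexFactor I ι x ≠ 0 := by
  obtain ⟨ι, hι, h⟩ := Finset.exists_ne_zero_of_sum_ne_zero hx
  exact ⟨ι, hι, left_ne_zero_of_mul (left_ne_zero_of_mul h)⟩

/-- The derivatives of all the `Φ_{J,β}` are supported in one ball. -/
theorem exists_radius_iteratedFDeriv_Phi : ∃ r : ℝ, 0 ≤ r ∧ ∀ (α : Pt d → ℝ) (β : Fin nE → ℤˣ)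
    (j : Fin nE → ℕ) (i : ℕ) (x : Fin nV → Pt d),
      iteratedFDeriv ℝ i (γ.Phi I α β j) x ≠ 0 → ‖x‖ ≤ r := by
  obtain ⟨r, hr0, hr⟩ := γ.exists_support_radius I
  refine ⟨r, hr0, fun α β j i x hx => ?_⟩
  have h1 : tsupport (γ.Phi I α β j) ⊆ Metric.closedBall 0 r :=
    closure_minimal (fun y hy => by
      obtain ⟨ι, hι, h⟩ := γ.exists_vertexFactor_of_Phi_ne_zero I hy
      exact mem_closedBall_zero_iff.2 (hr ι hι y h)) Metric.isClosed_closedBall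
  exact mem_closedBall_zero_iff.1 (h1 (support_iteratedFDeriv_subset i hx))

theorem hasCompactSupport_Phi (α : Pt d → ℝ) (β : Fin nE → ℤˣ) (j : Fin nE → ℕ) :
    HasCompactSupport (γ.Phi I α β j) := by
  obtain ⟨r, -, hr⟩ := γ.exists_support_radius I
  refine HasCompactSupport.intro (isCompact_closedBall 0 r) fun x hx => ?_
  by_contra h
  obtain ⟨ι, hι, h⟩ := γ.exists_vertexFactor_of_Phi_ne_zero I h
  exact hx (mem_closedBall_zero_iff.2 (hr ι hι x h))

/-- In each summand the background factor is smooth, compactly supported and independent of α, so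
its derivatives are bounded by constants; the Leibniz rule leaves the tails to the C^p norms. -/
theorem exists_norm_iteratedFDeriv_Phi_le (M : ℕ) : ∃ C : ℝ, 0 ≤ C ∧
    ∀ β : Fin nE → ℤˣ, ∀ j ∈ multiIndices (Fin nE) (γ.totalOrder I),
    ∀ α : Pt d → ℝ, ContDiff ℝ ∞ α → HasCompactSupport α → ∀ x ∈ halfSpaceConfig d nV,
      ‖iteratedFDeriv ℝ M (γ.Phi I α β j) x‖ ≤
        C * ∑ p ∈ multiIndices (Fin nT) (γ.totalOrder I + M), ∏ h, CpNorm (p h) α := by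
  have hB : ∀ (β : Fin nE → ℤˣ) (j : Fin nE → ℕ) (ι : HalfEdge nE nT → Fin (d + 1) → ℕ) (i : ℕ),
      ∃ B : ℝ, 0 ≤ B ∧ (ι ∈ γ.derivAssignments I →
        ∀ x, ‖iteratedFDeriv ℝ i (γ.backgroundFactor I β j ι) x‖ ≤ B) := by
    intro β j ι i
    by_cases hι : ι ∈ γ.derivAssignments I
    · obtain ⟨B, hB⟩ := ((γ.contDiff_backgroundFactor I β j ι).continuous_iteratedFDeriv
        (m := i) (by exact_mod_cast le_top)).bounded_above_of_compact_support
          ((γ.hasCompactSupport_backgroundFactor I hι β j).iteratedFDeriv i)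
      exact ⟨B, (norm_nonneg _).trans (hB 0), fun _ => hB⟩
    -- A default value, so that `choose` gives a bound for every assignment.
    · exact ⟨0, le_rfl, fun h => absurd h hι⟩
  choose B hB0 hB using hB
  set D : ℕ → ℝ := fun q =>
    ∑ p ∈ (Finset.univ : Finset (Fin nT)).sym q, ((p : Multiset (Fin nT)).countPerms : ℝ) with hD
  have hD0 : ∀ q, 0 ≤ D q := fun q => Finset.sum_nonneg fun _ _ => Nat.cast_nonneg _
  set A : (Fin nE → ℤˣ) → (Fin nE → ℕ) → ℝ := fun β j => ∑ ι ∈ γ.derivAssignments I,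
    ∑ i ∈ Finset.range (M + 1), (M.choose i : ℝ) * B β j ι i * D (M - i) with hA
  have hA0 : ∀ β j, 0 ≤ A β j := fun β j => Finset.sum_nonneg fun ι _ =>
    Finset.sum_nonneg fun i _ => mul_nonneg (mul_nonneg (Nat.cast_nonneg _) (hB0 _ _ _ _)) (hD0 _)
  refine ⟨∑ β, ∑ j ∈ multiIndices (Fin nE) (γ.totalOrder I), A β j,
    Finset.sum_nonneg fun β _ => Finset.sum_nonneg fun j _ => hA0 β j,
    fun β j hj α hα hc x hx => ?_⟩
  set S := ∑ p ∈ multiIndices (Fin nT) (γ.totalOrder I + M), ∏ h, CpNorm (p h) α with hS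
  have hS0 : 0 ≤ S := Finset.sum_nonneg fun p _ => Finset.prod_nonneg fun h _ => CpNorm_nonneg _ _
  have hle : A β j ≤ ∑ β, ∑ j ∈ multiIndices (Fin nE) (γ.totalOrder I), A β j :=
    (Finset.single_le_sum (f := A β) (fun j _ => hA0 β j) hj).trans
      (Finset.single_le_sum (f := fun β => ∑ j ∈ multiIndices (Fin nE) (γ.totalOrder I), A β j)
        (fun β _ => Finset.sum_nonneg fun j _ => hA0 β j) (Finset.mem_univ β))
  refine le_trans ?_ (mul_le_mul_of_nonneg_right hle hS0)
  have hPhi : γ.Phi I α β j = fun x => ∑ ι ∈ γ.derivAssignments I,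
    γ.backgroundFactor I β j ι x * γ.tailFactor α ι x := rfl
  have hM : ((M : ℕ) : ℕ∞ω) ≤ ∞ := by exact_mod_cast le_top
  rw [hPhi, iteratedFDeriv_fun_sum_apply fun ι _ =>
    (((γ.contDiff_backgroundFactor I β j ι).mul (γ.contDiff_tailFactor hα ι)).of_le hM).contDiffAt]
  refine (norm_sum_le _ _).trans ?_
  rw [hA, Finset.sum_mul]
  refine Finset.sum_le_sum fun ι hι => ?_
  refine (norm_iteratedFDeriv_mul_le (γ.contDiff_backgroundFactor I β j ι)
    (γ.contDiff_tailFactor hα ι) x hM).trans ?_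
  rw [Finset.sum_mul]
  refine Finset.sum_le_sum fun i _ => ?_
  rw [mul_assoc (_ * _)]
  exact mul_le_mul (mul_le_mul_of_nonneg_left (hB _ _ _ _ hι x) (Nat.cast_nonneg _))
    (γ.norm_iteratedFDeriv_tailFactor_le I hα hc hι (Nat.sub_le _ _) hx) (norm_nonneg _)
    (mul_nonneg (Nat.cast_nonneg _) (hB0 _ _ _ _))

end StableGraph

/-! ## Taylor expansion along the diagonal -/

section Taylor

variable {E G : Type*} [NormedAddCommGroup E] [NormedSpace ℝ E] [NormedAddCommGroup G]
  [NormedSpace ℝ G]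

theorem iteratedFDeriv_comp_const_add {f : E → ℝ} (hf : ContDiff ℝ ∞ f) (a : E) (L : G →L[ℝ] E)
    (j : ℕ) (y : G) (v : Fin j → G) :
    iteratedFDeriv ℝ j (fun y => f (a + L y)) y v =
      iteratedFDeriv ℝ j f (a + L y) fun i => L (v i) := by
  have h1 : ContDiff ℝ ∞ fun z => f (a + z) := hf.comp (contDiff_const.add contDiff_id)
  have h2 := L.iteratedFDeriv_comp_right h1 y (i := j) (by exact_mod_cast le_top)
  have h3 : (fun y => f (a + L y)) = (fun z => f (a + z)) ∘ L := rfl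
  rw [h3, h2, iteratedFDeriv_comp_add_left]
  rfl

/-- One-variable Taylor expansion of s ↦ f(a + s h) on [0, 1]; the factorial in the remainder is
discarded. -/
theorem abs_sub_taylor_le {f : E → ℝ} (hf : ContDiff ℝ ∞ f) (a h : E) (N : ℕ) {B : ℝ}
    (hB : ∀ s ∈ Set.Icc (0 : ℝ) 1, ‖iteratedFDeriv ℝ (N + 1) f (a + s • h)‖ ≤ B) :
    |f (a + h) - ∑ j ∈ Finset.range (N + 1),
      ((j.factorial : ℝ))⁻¹ * iteratedFDeriv ℝ j f a (fun _ => h)| ≤ B * ‖h‖ ^ (N + 1) := by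
  set L : ℝ →L[ℝ] E := ContinuousLinearMap.toSpanSingleton ℝ h
  set g : ℝ → ℝ := fun s => f (a + L s) with hg
  have hgs : ContDiff ℝ ∞ g := hf.comp (contDiff_const.add L.contDiff)
  have hder : ∀ (j : ℕ) (s : ℝ), iteratedDeriv j g s =
      iteratedFDeriv ℝ j f (a + s • h) fun _ => h := fun j s => by
    rw [iteratedDeriv_eq_iteratedFDeriv, iteratedFDeriv_comp_const_add hf]
    simp [L]
  have hw : ∀ (j : ℕ), ∀ s ∈ Set.Icc (0 : ℝ) 1,
      iteratedDerivWithin j g (Set.Icc 0 1) s = iteratedDeriv j g s := fun j s hs =>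
    iteratedDerivWithin_eq_iteratedDeriv (uniqueDiffOn_Icc zero_lt_one)
      (hgs.of_le (by exact_mod_cast le_top)).contDiffAt hs
  have key := taylor_mean_remainder_bound (f := g) (a := 0) (b := 1) (x := 1) (n := N)
    (C := B * ‖h‖ ^ (N + 1)) zero_le_one
    (hgs.of_le (by exact_mod_cast le_top)).contDiffOn (by simp) fun s hs => by
      rw [hw _ s hs, hder]
      refine (ContinuousMultilinearMap.le_opNorm _ _).trans ?_
      rw [Finset.prod_const, Finset.card_univ, Fintype.card_fin]
      exact mul_le_mul_of_nonneg_right (hB s hs) (by positivity)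
  rw [taylor_within_apply, Real.norm_eq_abs] at key
  have h1 : g 1 = f (a + h) := by simp [hg, L]
  have hB0 : 0 ≤ B := (norm_nonneg _).trans (hB 0 (by simp))
  rw [h1] at key
  refine le_trans (le_of_eq ?_) (key.trans ?_)
  · refine congrArg abs (congrArg _ (Finset.sum_congr rfl fun j _ => ?_))
    rw [hw j 0 (by simp), hder]
    simp
  · rw [sub_zero, one_pow, mul_one]
    exact div_le_self (by positivity) (by exact_mod_cast N.factorial_pos)

end Taylor

/-! ### Barycentre and displacement in place of the tree coordinates -/

/-- The barycentre of a configuration of points. -/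
def bary (d m : ℕ) : (Fin (m + 1) → Pt d) →L[ℝ] Pt d :=
  ((m : ℝ) + 1)⁻¹ • ∑ v, ContinuousLinearMap.proj (R := ℝ) (φ := fun _ => Pt d) v

theorem bary_apply {d m : ℕ} (x : Fin (m + 1) → Pt d) :
    bary d m x = ((m : ℝ) + 1)⁻¹ • ∑ v, x v := by
  simp [bary]

theorem bary_const {d m : ℕ} (a : Pt d) : bary d m (fun _ => a) = a := by
  rw [bary_apply, Finset.sum_const, Finset.card_univ, Fintype.card_fin, ← Nat.cast_smul_eq_nsmul ℝ,
    smul_smul, Nat.cast_add, Nat.cast_one, inv_mul_cancel₀ (by positivity), one_smul]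

/-- The displacement of a configuration of points from its barycentre. -/
def displ (d m : ℕ) : (Fin (m + 1) → Pt d) →L[ℝ] (Fin (m + 1) → Pt d) :=
  ContinuousLinearMap.id ℝ _ - ContinuousLinearMap.pi fun _ => bary d m

theorem displ_apply {d m : ℕ} (x : Fin (m + 1) → Pt d) :
    displ d m x = x - fun _ => bary d m x := rfl

theorem bary_displ {d m : ℕ} (x : Fin (m + 1) → Pt d) : bary d m (displ d m x) = 0 := by
  rw [displ_apply, map_sub, bary_const, sub_self]

/-- The z-terms telescope, so the normal coordinates of the m + 1 points add up to (m + 1)u. -/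
theorem uCoord_eq {d m : ℕ} (x : Fin (m + 1) → Pt d) :
    StableGraph.uCoord x = bary d m x (Fin.last d) := by
  set zu := normalCoords m fun v => x v (Fin.last d) with hzu
  have h1 : normalMap m zu = fun v => x v (Fin.last d) := by
    have : (normalCoords m).symm zu = fun v => x v (Fin.last d) := by simp [hzu]
    exact this
  have h2 : ∑ v, x v (Fin.last d) = ((m : ℝ) + 1) * zu.2 := by
    calc ∑ v, x v (Fin.last d) = ∑ v, normalMap m zu v := by rw [h1]
      _ = _ := by
        simp only [normalMap, LinearMap.coe_mk, AddHom.coe_mk]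
        rw [Finset.sum_add_distrib, Finset.sum_sub_distrib, Fin.sum_univ_castSucc (Fin.snoc zu.1 0),
          Fin.sum_univ_succ (Fin.cons 0 zu.1)]
        simp
  rw [bary_apply, Pi.smul_apply, Finset.sum_apply, h2, smul_eq_mul,
    inv_mul_cancel_left₀ (by positivity)]
  rfl

namespace StableGraph

variable {d m k l : ℕ} (γ : StableGraph (m + 1) (k + 1) l)
variable {F : Finset (Fin (k + 1))} (hF : γ.IsSpanningTree F)

/-- For ȳ = 0 and z = 0 all points coincide; their common position is then read off from w̄ and u.
-/
theorem ofCoords_zero (x : Fin (m + 1) → Pt d) :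
    γ.ofCoords hF (wCoord x) (uCoord x) 0 = fun _ => bary d m x := by
  funext v c
  refine Fin.lastCases ?_ (fun i => ?_) c
  · have h1 : normalMap m (0, uCoord x) = fun _ => uCoord x := by
      funext v
      have h2 : (Fin.snoc (0 : Fin m → ℝ) 0 : Fin (m + 1) → ℝ) v = 0 := by
        refine Fin.lastCases ?_ (fun i => ?_) v <;> simp
      have h3 : (Fin.cons 0 (0 : Fin m → ℝ) : Fin (m + 1) → ℝ) v = 0 := by
        refine Fin.cases ?_ (fun i => ?_) v <;> simp
      simp [normalMap, h2, h3]
    have h2 : (normalCoords m).symm (0, uCoord x) = fun _ => uCoord x := h1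
    simp only [ofCoords, Fin.snoc_last, Prod.snd_zero]
    rw [h2, uCoord_eq]
  · have h1 : (γ.treeCoords hF) (fun _ => bary d m x i.castSucc) =
        ((fun e => (0 : FibreCoords d m F).1 e i), wCoord x i) := by
      change γ.treeMap F _ = _
      refine Prod.ext ?_ ?_
      · funext e; simp [treeMap]
      · simp only [treeMap, LinearMap.coe_mk, AddHom.coe_mk, Finset.sum_const, Finset.card_univ,
          Fintype.card_fin, nsmul_eq_mul, wCoord, bary_apply, Pi.smul_apply, smul_eq_mul,
          Finset.sum_apply]
        push_cast
        rw [mul_inv_cancel_left₀ (by positivity)]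
    simp only [ofCoords, Fin.snoc_castSucc, ← h1, LinearEquiv.symm_apply_apply]

/-- The fibre coordinates as linear coordinates on configurations with barycentre `0`. -/
def fibreMap : FibreCoords d m F →ₗ[ℝ] (Fin (m + 1) → Pt d) where
  toFun := γ.ofCoords hF 0 0
  map_add' a b := by
    funext v c
    refine Fin.lastCases ?_ (fun i => ?_) c
    · have h : ((a + b).2, (0 : ℝ)) = (a.2, 0) + (b.2, 0) := by simp
      simp only [ofCoords, Fin.snoc_last, Pi.add_apply, h, map_add]
    · have h : ((fun e => (a + b).1 e i, (0 : Fin d → ℝ) i) : (F → ℝ) × ℝ) =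
          (fun e => a.1 e i, (0 : Fin d → ℝ) i) + (fun e => b.1 e i, (0 : Fin d → ℝ) i) := by
        refine Prod.ext rfl ?_
        simp
      simp only [ofCoords, Fin.snoc_castSucc, Pi.add_apply, h, map_add]
  map_smul' r a := by
    funext v c
    refine Fin.lastCases ?_ (fun i => ?_) c
    · have h : ((r • a).2, (0 : ℝ)) = r • (a.2, (0 : ℝ)) := by simp
      simp only [ofCoords, Fin.snoc_last, Pi.smul_apply, h, map_smul, RingHom.id_apply]
    · have h : ((fun e => (r • a).1 e i, (0 : Fin d → ℝ) i) : (F → ℝ) × ℝ) =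
          r • (fun e => a.1 e i, (0 : Fin d → ℝ) i) := by
        refine Prod.ext rfl ?_
        simp
      simp only [ofCoords, Fin.snoc_castSucc, Pi.smul_apply, h, map_smul, RingHom.id_apply]

theorem ofCoords_eq_add (w : Fin d → ℝ) (u : ℝ) (yz : FibreCoords d m F) :
    γ.ofCoords hF w u yz = γ.ofCoords hF w u 0 + γ.fibreMap hF yz := by
  funext v c
  refine Fin.lastCases ?_ (fun i => ?_) c
  · have h : (yz.2, u) = ((0 : FibreCoords d m F).2, u) + (yz.2, 0) := by simp
    simp only [fibreMap, LinearMap.coe_mk, AddHom.coe_mk, ofCoords, Fin.snoc_last, Pi.add_apply]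
    rw [h, map_add, Pi.add_apply]
  · have h : ((fun e => yz.1 e i, w i) : (F → ℝ) × ℝ) =
        (fun e => (0 : FibreCoords d m F).1 e i, w i) + (fun e => yz.1 e i, (0 : Fin d → ℝ) i) := by
      refine Prod.ext ?_ ?_
      · funext e; simp
      · simp
    simp only [fibreMap, LinearMap.coe_mk, AddHom.coe_mk, ofCoords, Fin.snoc_castSucc, Pi.add_apply]
    rw [h, map_add, Pi.add_apply]

theorem fibreMap_fibreCoords (x : Fin (m + 1) → Pt d) :
    γ.fibreMap hF (γ.fibreCoords x) = displ d m x := by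
  have h := γ.ofCoords_coords hF x
  rw [ofCoords_eq_add, ofCoords_zero] at h
  rw [displ_apply, eq_sub_iff_add_eq]
  exact (add_comm _ _).trans h

/-- The Taylor polynomial in `(ȳ, z)`, expressed without coordinates. -/
theorem taylorPhi_eq {Φ : (Fin (m + 1) → Pt d) → ℝ} (hΦ : ContDiff ℝ ∞ Φ) (N : ℕ)
    (x : Fin (m + 1) → Pt d) :
    γ.taylorPhi hF N Φ x = ∑ j ∈ Finset.range (N + 1), ((j.factorial : ℝ))⁻¹ *
      iteratedFDeriv ℝ j Φ (fun _ => bary d m x) (fun _ => displ d m x) := by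
  set L : FibreCoords d m F →L[ℝ] (Fin (m + 1) → Pt d) :=
    LinearMap.toContinuousLinearMap (γ.fibreMap hF) with hL
  have hLx : ∀ y, L y = γ.fibreMap hF y := fun _ => rfl
  simp only [taylorPhi, taylorPoly]
  refine Finset.sum_congr rfl fun j _ => congrArg _ ?_
  have h1 : (fun yz : FibreCoords d m F => Φ (γ.ofCoords hF (wCoord x) (uCoord x) yz)) =
      fun yz => Φ ((fun _ => bary d m x) + L yz) := by
    funext yz
    rw [ofCoords_eq_add, ofCoords_zero, hLx]
  rw [h1, iteratedFDeriv_comp_const_add hΦ, map_zero, add_zero]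
  simp only [hLx, fibreMap_fibreCoords]

end StableGraph

/-! ## Gaussian integrals -/

section Gauss

variable {H : Type*} [NormedAddCommGroup H] [NormedSpace ℝ H] [FiniteDimensional ℝ H]
  [MeasurableSpace H] [BorelSpace H] (μ : Measure H) [μ.IsAddHaarMeasure]

/-- Completing the square gives -c s² ≤ 1/(4c) - s, and the exponential series bounds (1 +
s)^(q+D+1) by (q+D+1)! e^(1+s). Together they give decay like (1 + s)^(-(D+1)), which is integrable
in dimension D. -/
theorem integrable_norm_pow_mul_exp_neg (q : ℕ) {c : ℝ} (hc : 0 < c) :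
    Integrable (fun h : H => ‖h‖ ^ q * Real.exp (-(c * ‖h‖ ^ 2))) μ := by
  set D := Module.finrank ℝ H
  set A : ℝ := ((q + (D + 1)).factorial : ℝ) * Real.exp (1 / (4 * c) + 1) with hA
  have h1 : Integrable (fun h : H => A * (1 + ‖h‖) ^ (-((D + 1 : ℕ) : ℝ))) μ :=
    (integrable_one_add_norm (by push_cast; exact lt_add_one _)).const_mul A
  refine h1.mono' (Continuous.aestronglyMeasurable (by fun_prop)) (Filter.Eventually.of_forall ?_)
  intro h
  set s := ‖h‖ with hs
  have hs0 : 0 ≤ s := norm_nonneg h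
  rw [Real.norm_of_nonneg (by positivity), Real.rpow_neg (by positivity), Real.rpow_natCast,
    ← div_eq_mul_inv, le_div_iff₀ (by positivity)]
  have h2 : (1 + s) ^ (q + (D + 1)) ≤ ((q + (D + 1)).factorial : ℝ) * Real.exp (1 + s) := by
    have := Real.pow_div_factorial_le_exp (x := 1 + s) (by positivity) (q + (D + 1))
    rwa [div_le_iff₀ (by positivity), mul_comm] at this
  have h3 : -(c * s ^ 2) ≤ 1 / (4 * c) - s := by
    have : c * s ^ 2 - s + 1 / (4 * c) = c * (s - 1 / (2 * c)) ^ 2 := by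
      field_simp; ring
    have h4 : 0 ≤ c * (s - 1 / (2 * c)) ^ 2 := by positivity
    linarith
  calc s ^ q * Real.exp (-(c * s ^ 2)) * (1 + s) ^ (D + 1)
      ≤ (1 + s) ^ q * Real.exp (-(c * s ^ 2)) * (1 + s) ^ (D + 1) := by
        gcongr; linarith
    _ = (1 + s) ^ (q + (D + 1)) * Real.exp (-(c * s ^ 2)) := by ring
    _ ≤ ((q + (D + 1)).factorial : ℝ) * Real.exp (1 + s) * Real.exp (1 / (4 * c) - s) := by
        gcongr
    _ = A := by
        rw [hA, mul_assoc, ← Real.exp_add]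
        congr 2; ring

/-- Substitute h = √T h': the norm contributes q factors √T and the measure one for each dimension.
-/
theorem integral_norm_pow_mul_exp_neg_div (q : ℕ) (κ : ℝ) {T : ℝ} (hT : 0 < T) :
    ∫ h : H, ‖h‖ ^ q * Real.exp (-(κ / T * ‖h‖ ^ 2)) ∂μ =
      T ^ (((q : ℝ) + Module.finrank ℝ H) / 2) *
        ∫ h : H, ‖h‖ ^ q * Real.exp (-(κ * ‖h‖ ^ 2)) ∂μ := by
  have hs : 0 < Real.sqrt T := Real.sqrt_pos.2 hT
  have h2 : Real.sqrt T ^ 2 = T := Real.sq_sqrt hT.le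
  have h := Measure.integral_comp_inv_smul_of_nonneg μ
    (fun h : H => ‖h‖ ^ q * Real.exp (-(κ * ‖h‖ ^ 2))) hs.le
  have h1 : ∀ h : H, ‖h‖ ^ q * Real.exp (-(κ / T * ‖h‖ ^ 2)) = Real.sqrt T ^ q *
      (‖(Real.sqrt T)⁻¹ • h‖ ^ q * Real.exp (-(κ * ‖(Real.sqrt T)⁻¹ • h‖ ^ 2))) := fun h => by
    rw [norm_smul, Real.norm_of_nonneg (inv_nonneg.2 hs.le), mul_pow, mul_pow, inv_pow, inv_pow, h2]
    have : κ / T * ‖h‖ ^ 2 = κ * (T⁻¹ * ‖h‖ ^ 2) := by ring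
    rw [this]
    field_simp
  simp only [h1]
  rw [integral_const_mul, h, smul_eq_mul, ← mul_assoc, ← pow_add]
  congr 1
  rw [Real.sqrt_eq_rpow, ← Real.rpow_natCast, ← Real.rpow_mul hT.le]
  push_cast
  ring_nf

end Gauss

/-- The function `x ↦ ‖x - b‖^q exp(-c ‖x - b‖²)` of a configuration with barycentre `b`, cut off
to barycentres in a ball of radius `r`. -/
def gaussBound (d m : ℕ) (r : ℝ) (q : ℕ) (c : ℝ) (x : Fin (m + 1) → Pt d) : ℝ :=
  ‖displ d m x‖ ^ q * Real.exp (-(c * ‖displ d m x‖ ^ 2)) *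
    (Metric.closedBall (0 : Pt d) r).indicator (fun _ => (1 : ℝ)) (bary d m x)

theorem gaussBound_nonneg {d m : ℕ} (r : ℝ) (q : ℕ) (c : ℝ) (x : Fin (m + 1) → Pt d) :
    0 ≤ gaussBound d m r q c x :=
  mul_nonneg (by positivity) (Set.indicator_nonneg (fun _ _ => zero_le_one) _)

/-- Displacement from the barycentre and barycentre, as coordinates. -/
def displEquiv (d m : ℕ) :
    (Fin (m + 1) → Pt d) ≃L[ℝ] (LinearMap.ker (bary d m : (Fin (m + 1) → Pt d) →ₗ[ℝ] Pt d)) × Pt d :=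
  LinearEquiv.toContinuousLinearEquiv
    { toFun := fun x => (⟨displ d m x, bary_displ x⟩, bary d m x)
      map_add' := fun x y => by
        refine Prod.ext (Subtype.ext ?_) ?_ <;> simp
      map_smul' := fun a x => by
        refine Prod.ext (Subtype.ext ?_) ?_ <;> simp
      invFun := fun p => p.1.1 + fun _ => p.2
      left_inv := fun x => by
        simp [displ_apply]
      right_inv := fun p => by
        have h : bary d m (p.1.1 + fun _ => p.2) = p.2 := by
          have h0 : bary d m p.1.1 = 0 := p.1.2
          rw [map_add, bary_const, h0, zero_add]
        refine Prod.ext (Subtype.ext ?_) h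
        simp [displ_apply, h] }

theorem finrank_ker_bary (d m : ℕ) :
    Module.finrank ℝ (LinearMap.ker (bary d m : (Fin (m + 1) → Pt d) →ₗ[ℝ] Pt d)) =
      m * (d + 1) := by
  have h := (displEquiv d m).toLinearEquiv.finrank_eq
  rw [Module.finrank_prod] at h
  simp only [Module.finrank_pi_fintype, Module.finrank_self, Finset.sum_const, Finset.card_univ,
    Fintype.card_fin, smul_eq_mul, mul_one] at h
  linarith

/-- In the coordinates `displEquiv`, Lebesgue measure is a constant multiple of a product of Haar
measures. The integral thus splits into a Gaussian one over displacements, of dimension m(d + 1),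
which carries all dependence on T, and the volume of a ball of barycentres. -/
theorem exists_integral_gaussBound (d m : ℕ) (r : ℝ) (q : ℕ) {κ : ℝ} (hκ : 0 < κ) :
    (∀ T : ℝ, 0 < T → Integrable (gaussBound d m r q (κ / T))) ∧ ∃ C : ℝ, 0 ≤ C ∧
      ∀ T : ℝ, 0 < T → ∫ x, gaussBound d m r q (κ / T) x =
        C * T ^ (((q : ℝ) + m * ((d : ℝ) + 1)) / 2) := by
  set H := LinearMap.ker (bary d m : (Fin (m + 1) → Pt d) →ₗ[ℝ] Pt d) with hH
  let μ : Measure H := Measure.addHaar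
  let ν : Measure (H × Pt d) := μ.prod volume
  have hμ : μ.IsAddHaarMeasure := inferInstanceAs (Measure.addHaar (G := H)).IsAddHaarMeasure
  have hν : ν.IsAddHaarMeasure := Measure.prod.instIsAddHaarMeasure μ volume
  let e : (Fin (m + 1) → Pt d) ≃L[ℝ] H × Pt d := displEquiv d m
  have he : (volume.map e).IsAddHaarMeasure := e.isAddHaarMeasure_map volume
  set a := Measure.addHaarScalarFactor (volume.map e) ν
  have hmap : volume.map e = a • ν := Measure.isAddLeftInvariant_eq_smul _ _
  let G : ℝ → H × Pt d → ℝ := fun T p => (‖p.1‖ ^ q * Real.exp (-(κ / T * ‖p.1‖ ^ 2))) *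
    (Metric.closedBall (0 : Pt d) r).indicator (fun _ => (1 : ℝ)) p.2
  have hG : ∀ T, gaussBound d m r q (κ / T) = G T ∘ e := fun T => rfl
  have hball : Integrable ((Metric.closedBall (0 : Pt d) r).indicator fun _ => (1 : ℝ)) := by
    rw [integrable_indicator_iff Metric.isClosed_closedBall.measurableSet]
    exact integrableOn_const (isCompact_closedBall 0 r).measure_lt_top.ne
  have hint : ∀ T, 0 < T → Integrable (G T) (volume.map e) := fun T hT => by
    rw [hmap]
    refine Integrable.smul_measure_nnreal ?_
    exact (integrable_norm_pow_mul_exp_neg μ q (div_pos hκ hT)).mul_prod hball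
  refine ⟨fun T hT => ?_, (a : ℝ) * ((∫ h : H, ‖h‖ ^ q * Real.exp (-(κ * ‖h‖ ^ 2)) ∂μ) *
    ∫ b, (Metric.closedBall (0 : Pt d) r).indicator (fun _ => (1 : ℝ)) b), ?_, fun T hT => ?_⟩
  · rw [hG]
    exact (hint T hT).comp_measurable e.continuous.measurable
  · refine mul_nonneg a.2 (mul_nonneg (integral_nonneg fun h => by positivity)
      (integral_nonneg fun b => Set.indicator_nonneg (fun _ _ => zero_le_one) _))
  · have h1 : ∫ x, gaussBound d m r q (κ / T) x = ∫ p, G T p ∂(volume.map e) :=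
      (integral_map_equiv e.toHomeomorph.toMeasurableEquiv (G T)).symm
    rw [h1, hmap, integral_smul_nnreal_measure, integral_prod_mul
      (fun h : H => ‖h‖ ^ q * Real.exp (-(κ / T * ‖h‖ ^ 2))),
      integral_norm_pow_mul_exp_neg_div μ q κ hT, finrank_ker_bary, NNReal.smul_def, smul_eq_mul]
    push_cast
    ring

/-! ## The lower bound for the quadratic form -/

/-- The reflected square exceeds the direct one by 4 x_n y_n, which is positive on the half-space.
-/
theorem sqDist_le_sqDist_reflPt {d : ℕ} (b : ℤˣ) {x y : Pt d} (hx : x ∈ halfSpace d)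
    (hy : y ∈ halfSpace d) : sqDist x y ≤ sqDist x (reflPt b y) := by
  refine Finset.sum_le_sum fun i _ => ?_
  by_cases hi : i = Fin.last d
  · subst hi
    have hx' : 0 < x (Fin.last d) := hx
    have hy' : 0 < y (Fin.last d) := hy
    have := mul_pos hx' hy'
    rcases Int.units_eq_one_or b with rfl | rfl
    · simp [reflPt, reflSign]
    · simp [reflPt, reflSign]
      nlinarith
  · simp [reflPt, reflSign, hi]

namespace StableGraph

variable {m k l : ℕ} (γ : StableGraph (m + 1) (k + 1) l)
variable {F : Finset (Fin (k + 1))}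

/-- The differences along the edges. -/
def edgeDiff (d : ℕ) : (Fin (m + 1) → Pt d) →L[ℝ] (Fin (k + 1) → Pt d) :=
  ContinuousLinearMap.pi fun e =>
    ContinuousLinearMap.proj (R := ℝ) (φ := fun _ => Pt d) (γ.src e) -
      ContinuousLinearMap.proj (R := ℝ) (φ := fun _ => Pt d) (γ.tgt e)

/-- By connectedness, vanishing edge differences and barycentre force x = 0. An injective linear map
in finite dimension is bounded below, and it is applied here to a displacement, whose barycentre is
0. -/
theorem exists_norm_displ_le (hF : γ.IsSpanningTree F) (d : ℕ) : ∃ K : ℝ, 0 < K ∧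
    ∀ x : Fin (m + 1) → Pt d, ‖displ d m x‖ ≤ K * ‖γ.edgeDiff d x‖ := by
  set f : (Fin (m + 1) → Pt d) →L[ℝ] (Fin (k + 1) → Pt d) × Pt d :=
    (γ.edgeDiff d).prod (bary d m)
  have hker : LinearMap.ker (f : (Fin (m + 1) → Pt d) →ₗ[ℝ] (Fin (k + 1) → Pt d) × Pt d) = ⊥ := by
    rw [LinearMap.ker_eq_bot']
    intro x hx
    have h1 : ∀ e, x (γ.src e) = x (γ.tgt e) := fun e =>
      sub_eq_zero.1 (congrFun (congrArg Prod.fst hx) e)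
    have h2 : bary d m x = 0 := congrArg Prod.snd hx
    have h3 : ∀ a b, x a = x b := fun a b => by
      induction hF.1 a b with
      | rel a b h => obtain ⟨e, -, rfl, rfl⟩ := h; exact h1 e
      | refl => rfl
      | symm _ _ _ ih => exact ih.symm
      | trans _ _ _ _ _ ih ih' => exact ih.trans ih'
    funext a
    have h4 : x = fun _ => x a := funext fun b => h3 b a
    rw [h4, bary_const] at h2
    exact h2
  obtain ⟨K, hK, hanti⟩ := LinearMap.exists_antilipschitzWith _ hker
  refine ⟨K, hK, fun x => ?_⟩
  have h := hanti.le_mul_dist (displ d m x) 0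
  have h1 : f (displ d m x) = (γ.edgeDiff d x, 0) := by
    refine Prod.ext ?_ (bary_displ x)
    funext e
    simp [f, edgeDiff, displ_apply]
  simp only [ContinuousLinearMap.coe_coe, map_zero, dist_zero_right, h1] at h
  simpa [Prod.norm_def] using h

theorem exists_quadForm_ge (hF : γ.IsSpanningTree F) (d : ℕ) : ∃ κ : ℝ, 0 < κ ∧
    ∀ (β : Fin (k + 1) → ℤˣ) (t : Fin (k + 1) → ℝ) (T : ℝ), (∀ e, 0 < t e) → (∀ e, t e ≤ T) →
      ∀ x ∈ halfSpaceConfig d (m + 1), κ / T * ‖displ d m x‖ ^ 2 ≤ γ.quadForm β t x := by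
  obtain ⟨K, hK, h⟩ := γ.exists_norm_displ_le hF d
  -- The 4 is that of 4t in the heat kernel, and K² compares |x - b|² with the sum of squared edge
  -- lengths.
  refine ⟨1 / (4 * K ^ 2), by positivity, fun β t T ht htT x hx => ?_⟩
  have hT : 0 < T := (ht 0).trans_le (htT 0)
  set S := ∑ e, sqDist (x (γ.src e)) (x (γ.tgt e)) with hS
  have hsq : ∀ y z : Pt d, 0 ≤ sqDist y z := fun y z => Finset.sum_nonneg fun _ _ => sq_nonneg _
  have h1 : ‖γ.edgeDiff d x‖ ≤ Real.sqrt S := by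
    refine (pi_norm_le_iff_of_nonneg (Real.sqrt_nonneg _)).2 fun e =>
      (pi_norm_le_iff_of_nonneg (Real.sqrt_nonneg _)).2 fun i => Real.abs_le_sqrt ?_
    refine le_trans ?_ (Finset.single_le_sum (f := fun e => sqDist (x (γ.src e)) (x (γ.tgt e)))
      (fun e _ => hsq _ _) (Finset.mem_univ e))
    exact Finset.single_le_sum (f := fun i => (x (γ.src e) i - x (γ.tgt e) i) ^ 2)
      (fun i _ => sq_nonneg _) (Finset.mem_univ i)
  have hS0 : 0 ≤ S := Finset.sum_nonneg fun e _ => hsq _ _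
  have h2 : ‖displ d m x‖ ^ 2 ≤ K ^ 2 * S := by
    calc ‖displ d m x‖ ^ 2 ≤ (K * Real.sqrt S) ^ 2 := by
          gcongr; exact (h x).trans (mul_le_mul_of_nonneg_left h1 hK.le)
      _ = K ^ 2 * S := by rw [mul_pow, Real.sq_sqrt hS0]
  calc 1 / (4 * K ^ 2) / T * ‖displ d m x‖ ^ 2
      ≤ 1 / (4 * K ^ 2) / T * (K ^ 2 * S) := by gcongr
    _ = ∑ e, sqDist (x (γ.src e)) (x (γ.tgt e)) / (4 * T) := by
        rw [← Finset.sum_div, ← hS]; field_simp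
    _ ≤ γ.quadForm β t x := by
        refine Finset.sum_le_sum fun e _ => ?_
        have := ht e
        exact div_le_div₀ (hsq _ _) (sqDist_le_sqDist_reflPt _ (hx _) (hx _)) (by positivity)
          (by linarith [htT e])

end StableGraph

/-! ## The estimate -/

theorem measurableSet_halfSpaceConfig (d nV : ℕ) : MeasurableSet (halfSpaceConfig d nV) := by
  have : halfSpaceConfig d nV = ⋂ v, {x : Fin nV → Pt d | 0 < x v (Fin.last d)} := by
    ext x; simp [halfSpaceConfig, halfSpace]
  rw [this]
  exact MeasurableSet.iInter fun v => measurableSet_lt measurable_const (by fun_prop)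

theorem bary_mem_halfSpace {d m : ℕ} {x : Fin (m + 1) → Pt d} (hx : x ∈ halfSpaceConfig d (m + 1)) :
    bary d m x ∈ halfSpace d := by
  change 0 < bary d m x (Fin.last d)
  rw [bary_apply, Pi.smul_apply, Finset.sum_apply, smul_eq_mul]
  exact mul_pos (by positivity) (Finset.sum_pos (fun v _ => hx v) Finset.univ_nonempty)

/-- Convexity of the half-space. It keeps the Taylor remainder within the region seen by `CpNorm`.
-/
theorem const_bary_add_smul_displ_mem {d m : ℕ} {x : Fin (m + 1) → Pt d}
    (hx : x ∈ halfSpaceConfig d (m + 1)) {s : ℝ} (hs : s ∈ Set.Icc (0 : ℝ) 1) :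
    ((fun _ : Fin (m + 1) => bary d m x) + s • displ d m x) ∈ halfSpaceConfig d (m + 1) := by
  intro v
  have h1 : 0 < bary d m x (Fin.last d) := bary_mem_halfSpace hx
  have h2 : 0 < x v (Fin.last d) := hx v
  have h3 : ((fun _ : Fin (m + 1) => bary d m x) + s • displ d m x) v (Fin.last d) =
      (1 - s) * bary d m x (Fin.last d) + s * x v (Fin.last d) := by
    simp only [displ_apply, Pi.add_apply, Pi.smul_apply, Pi.sub_apply, smul_eq_mul]
    ring
  change 0 < ((fun _ : Fin (m + 1) => bary d m x) + s • displ d m x) v (Fin.last d)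
  rw [h3]
  rcases hs.2.eq_or_lt with rfl | h
  · simpa using h2
  · exact add_pos_of_pos_of_nonneg (mul_pos (sub_pos.2 h) h1) (mul_nonneg hs.1 h2.le)

theorem norm_bary_le {d m : ℕ} (x : Fin (m + 1) → Pt d) : ‖bary d m x‖ ≤ ‖x‖ := by
  rw [bary_apply, norm_smul, Real.norm_of_nonneg (by positivity), inv_mul_le_iff₀ (by positivity)]
  refine (norm_sum_le _ _).trans ((Finset.sum_le_sum fun v _ => norm_le_pi_norm x v).trans_eq ?_)
  simp

/-- The barycentre is constant along the segment, so if it is large the whole segment misses the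
support of Φ. -/
theorem bary_const_add_smul_displ {d m : ℕ} (x : Fin (m + 1) → Pt d) (s : ℝ) :
    bary d m ((fun _ => bary d m x) + s • displ d m x) = bary d m x := by
  rw [map_add, map_smul, bary_displ, bary_const, smul_zero, add_zero]

namespace StableGraph

section Continuity

variable {nV nE nT d : ℕ} (γ : StableGraph nV nE nT)

theorem continuous_quadForm (β : Fin nE → ℤˣ) (t : Fin nE → ℝ) :
    Continuous (γ.quadForm (d := d) β t) := by
  unfold quadForm sqDist reflPt
  fun_prop

theorem integrable_exp_mul_Phi (I : ∀ i r : ℕ, LocalFunctional d r) {α : Pt d → ℝ}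
    (hα : ContDiff ℝ ∞ α) (t : Fin nE → ℝ) (β : Fin nE → ℤˣ) (j : Fin nE → ℕ) :
    Integrable fun x => Real.exp (-γ.quadForm β t x) * γ.Phi I α β j x :=
  (((γ.continuous_quadForm β t).neg.rexp).mul
    (γ.contDiff_Phi I hα β j).continuous).integrable_of_hasCompactSupport
      (γ.hasCompactSupport_Phi I α β j).mul_left

end Continuity

variable {d m k l : ℕ} (γ : StableGraph (m + 1) (k + 1) l)
variable {F : Finset (Fin (k + 1))} (hF : γ.IsSpanningTree F)

theorem continuous_taylorPhi {Φ : (Fin (m + 1) → Pt d) → ℝ} (hΦ : ContDiff ℝ ∞ Φ) (N : ℕ) :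
    Continuous (γ.taylorPhi hF N Φ) := by
  have h : γ.taylorPhi hF N Φ = _ := funext (γ.taylorPhi_eq hF hΦ N)
  rw [h]
  refine continuous_finsetSum _ fun j _ => continuous_const.mul ?_
  have h1 : Continuous fun x : Fin (m + 1) → Pt d =>
      iteratedFDeriv ℝ j Φ fun _ => bary d m x :=
    (hΦ.continuous_iteratedFDeriv (by exact_mod_cast le_top)).comp
      (continuous_pi fun _ => (bary d m).continuous)
  exact h1.eval (continuous_pi fun _ => (displ d m).continuous)

/-- The common domination of the Taylor terms (q ≤ N) and of the remainder (q = N + 1). -/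
theorem exp_neg_quadForm_mul_le {κ r c T : ℝ} {β : Fin (k + 1) → ℤˣ} {t : Fin (k + 1) → ℝ}
    {x : Fin (m + 1) → Pt d} (hq : κ / T * ‖displ d m x‖ ^ 2 ≤ γ.quadForm β t x) {A : ℝ} {q : ℕ}
    (hc : 0 ≤ c) (hA : |A| ≤ c * ‖displ d m x‖ ^ q) (h0 : r < ‖bary d m x‖ → A = 0) :
    |Real.exp (-γ.quadForm β t x) * A| ≤ c * gaussBound d m r q (κ / T) x := by
  rcases lt_or_ge r ‖bary d m x‖ with hr | hr
  · rw [h0 hr, mul_zero, abs_zero]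
    exact mul_nonneg hc (gaussBound_nonneg _ _ _ _)
  · rw [gaussBound, Set.indicator_of_mem (mem_closedBall_zero_iff.2 hr), mul_one, abs_mul,
      abs_of_pos (Real.exp_pos _)]
    calc Real.exp (-γ.quadForm β t x) * |A|
        ≤ Real.exp (-(κ / T * ‖displ d m x‖ ^ 2)) * (c * ‖displ d m x‖ ^ q) := by
          gcongr
      _ = _ := by ring

/-- A Taylor polynomial is compactly supported in the barycentre only; in the displacement,
convergence comes from the Gaussian bound, which is available on the half-space. -/
theorem integrableOn_taylorIntegrand (I : ∀ i r : ℕ, LocalFunctional d r) (N : ℕ)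
    {t : Fin (k + 1) → ℝ} (ht : ∀ e, 0 < t e) {α : Pt d → ℝ} (hα : ContDiff ℝ ∞ α)
    (β : Fin (k + 1) → ℤˣ) (j : Fin (k + 1) → ℕ) :
    IntegrableOn (γ.taylorIntegrand hF I N t α β j) (halfSpaceConfig d (m + 1)) := by
  obtain ⟨κ, hκ, hquad⟩ := γ.exists_quadForm_ge hF d
  obtain ⟨r, -, hr⟩ := γ.exists_radius_iteratedFDeriv_Phi I
  have hΦ := γ.contDiff_Phi I hα β j
  have hB : ∀ i : ℕ, ∃ B, ∀ x, ‖iteratedFDeriv ℝ i (γ.Phi I α β j) x‖ ≤ B := fun i =>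
    (hΦ.continuous_iteratedFDeriv (by exact_mod_cast le_top)).bounded_above_of_compact_support
      ((γ.hasCompactSupport_Phi I α β j).iteratedFDeriv i)
  choose B hB using hB
  have hB0 : ∀ i, 0 ≤ B i := fun i => (norm_nonneg _).trans (hB i 0)
  -- Any common upper bound of the t_e would do, since only convergence is at stake.
  set T := ∑ e, t e with hT
  have htT : ∀ e, t e ≤ T := fun e =>
    Finset.single_le_sum (f := t) (fun e _ => (ht e).le) (Finset.mem_univ e)
  have hT0 : 0 < T := (ht 0).trans_le (htT 0)
  have hdom : Integrable fun x => ∑ i ∈ Finset.range (N + 1),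
      B i * gaussBound d m r i (κ / T) x :=
    integrable_finsetSum _ fun i _ =>
      ((exists_integral_gaussBound d m r i hκ).1 T hT0).const_mul _
  refine Integrable.mono' hdom.integrableOn ?_ ?_
  · exact (((γ.continuous_quadForm β t).neg.rexp).mul
      (γ.continuous_taylorPhi hF hΦ N)).aestronglyMeasurable
  · refine (ae_restrict_iff' (measurableSet_halfSpaceConfig d _)).2
      (Filter.Eventually.of_forall fun x hx => ?_)
    rw [taylorIntegrand, taylorPhi_eq γ hF hΦ, Finset.mul_sum, Real.norm_eq_abs]
    refine (Finset.abs_sum_le_sum_abs _ _).trans (Finset.sum_le_sum fun i _ => ?_)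
    refine γ.exp_neg_quadForm_mul_le (hquad β t T ht htT x hx) (hB0 i) ?_ fun h => ?_
    · rw [abs_mul, abs_of_nonneg (by positivity)]
      refine (mul_le_of_le_one_left (abs_nonneg _)
        (inv_le_one_of_one_le₀ (by exact_mod_cast i.factorial_pos))).trans ?_
      rw [← Real.norm_eq_abs]
      refine (ContinuousMultilinearMap.le_opNorm _ _).trans ?_
      rw [Finset.prod_const, Finset.card_univ, Fintype.card_fin]
      exact mul_le_mul_of_nonneg_right (hB i _) (by positivity)
    · have h0 : iteratedFDeriv ℝ i (γ.Phi I α β j) (fun _ => bary d m x) = 0 := by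
        by_contra hne
        have h1 := (norm_bary_le _).trans (hr α β j i _ hne)
        rw [bary_const] at h1
        exact absurd h1 (not_le.2 h)
      rw [h0, _root_.zero_apply, mul_zero]

/-- The estimate for one of the integrals in the expansion of `f_{γ,I}(t)[α]`. -/
theorem exists_integral_sub_taylor_le (I : ∀ i r : ℕ, LocalFunctional d r) (N : ℕ) :
    ∃ C : ℝ, 0 ≤ C ∧ ∀ β : Fin (k + 1) → ℤˣ, ∀ j ∈ multiIndices (Fin (k + 1)) (γ.totalOrder I),
      ∀ t : Fin (k + 1) → ℝ, (∀ e, 0 < t e) → ∀ T : ℝ, (∀ e, t e ≤ T) →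
      ∀ α : Pt d → ℝ, ContDiff ℝ ∞ α → HasCompactSupport α →
        |(∫ x in halfSpaceConfig d (m + 1), Real.exp (-γ.quadForm β t x) * γ.Phi I α β j x) -
          ∫ x in halfSpaceConfig d (m + 1), γ.taylorIntegrand hF I N t α β j x| ≤
        C * (∑ p ∈ multiIndices (Fin l) (γ.totalOrder I + N + 1), ∏ h, CpNorm (p h) α) *
          T ^ (((N : ℝ) + 1) / 2 + (m : ℝ) * (((d : ℝ) + 1) / 2)) := by
  obtain ⟨κ, hκ, hquad⟩ := γ.exists_quadForm_ge hF d
  obtain ⟨r, -, hr⟩ := γ.exists_radius_iteratedFDeriv_Phi I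
  obtain ⟨A, hA0, hA⟩ := γ.exists_norm_iteratedFDeriv_Phi_le I (N + 1)
  obtain ⟨hint, B, hB0, hB⟩ := exists_integral_gaussBound d m r (N + 1) hκ
  -- A bounds the derivatives of order N + 1 of Φ and B is the constant of the Gaussian integral;
  -- neither sees t or α.
  refine ⟨A * B, mul_nonneg hA0 hB0, fun β j hj t ht T htT α hα hc => ?_⟩
  have hT0 : 0 < T := (ht 0).trans_le (htT 0)
  set S := ∑ p ∈ multiIndices (Fin l) (γ.totalOrder I + N + 1), ∏ h, CpNorm (p h) α with hS
  have hS0 : 0 ≤ S := Finset.sum_nonneg fun p _ => Finset.prod_nonneg fun h _ => CpNorm_nonneg _ _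
  have hΦ := γ.contDiff_Phi I hα β j
  have hi2 := γ.integrableOn_taylorIntegrand hF I N ht hα β j
  rw [← integral_sub (γ.integrable_exp_mul_Phi I hα t β j).integrableOn hi2, ← Real.norm_eq_abs]
  have hpt : ∀ x ∈ halfSpaceConfig d (m + 1),
      ‖Real.exp (-γ.quadForm β t x) * γ.Phi I α β j x - γ.taylorIntegrand hF I N t α β j x‖ ≤
        A * S * gaussBound d m r (N + 1) (κ / T) x := by
    intro x hx
    rw [taylorIntegrand, ← mul_sub, Real.norm_eq_abs]
    have hzero : ∀ (i : ℕ) (s : ℝ), r < ‖bary d m x‖ → iteratedFDeriv ℝ i (γ.Phi I α β j)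
        ((fun _ => bary d m x) + s • displ d m x) = 0 := fun i s h => by
      by_contra hne
      have h1 := (norm_bary_le _).trans (hr α β j i _ hne)
      rw [bary_const_add_smul_displ] at h1
      exact absurd h1 (not_le.2 h)
    have hx1 : (fun _ => bary d m x) + displ d m x = x := by
      rw [displ_apply]; exact add_sub_cancel _ _
    have htay : ∀ D : ℝ, (∀ s ∈ Set.Icc (0 : ℝ) 1, ‖iteratedFDeriv ℝ (N + 1) (γ.Phi I α β j)
        ((fun _ => bary d m x) + s • displ d m x)‖ ≤ D) →
        |γ.Phi I α β j x - γ.taylorPhi hF N (γ.Phi I α β j) x| ≤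
          D * ‖displ d m x‖ ^ (N + 1) := fun D hD => by
      have h := abs_sub_taylor_le hΦ (fun _ => bary d m x) (displ d m x) N hD
      rwa [hx1, ← taylorPhi_eq γ hF hΦ] at h
    refine γ.exp_neg_quadForm_mul_le (hquad β t T ht htT x hx) (mul_nonneg hA0 hS0)
      (htay _ fun s hs => hA β j hj α hα hc _ (const_bary_add_smul_displ_mem hx hs)) fun h => ?_
    -- When the derivative of order N + 1 vanishes along the segment, Φ equals its Taylor polynomial
    -- at x.
    have h1 := htay 0 fun s _ => by rw [hzero _ _ h, norm_zero]
    rw [zero_mul] at h1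
    exact abs_nonpos_iff.1 h1
  refine (norm_integral_le_of_norm_le ((hint T hT0).const_mul (A * S)).integrableOn
    ((ae_restrict_iff' (measurableSet_halfSpaceConfig d _)).2
      (Filter.Eventually.of_forall hpt))).trans ?_
  refine (setIntegral_le_integral ((hint T hT0).const_mul (A * S)) (Filter.Eventually.of_forall
    fun x => mul_nonneg (mul_nonneg hA0 hS0) (gaussBound_nonneg _ _ _ _))).trans_eq ?_
  rw [integral_const_mul, hB T hT0]
  have : (((N + 1 : ℕ) : ℝ) + m * ((d : ℝ) + 1)) / 2 =
      ((N : ℝ) + 1) / 2 + (m : ℝ) * (((d : ℝ) + 1) / 2) := by push_cast; ring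
  rw [this]
  ring

/-- All exponents are negative, so t_e may be replaced by its lower bound T^R; then T ≤ 1 allows |j|
to be raised to O. -/
theorem prod_rpow_le {t : Fin (k + 1) → ℝ} (ht : ∀ e, 0 < t e) (hmono : Monotone t) {R : ℝ}
    (hR : 1 < R) (htR : t (Fin.last k) ^ R ≤ t 0) {j : Fin (k + 1) → ℕ} {O : ℕ}
    (hj : ∑ e, j e ≤ O) (d : ℕ) :
    ∏ e, t e ^ (-(j e : ℝ) - ((d : ℝ) + 1) / 2) ≤
      t (Fin.last k) ^ (-(R * (O : ℝ)) - R * ((k : ℝ) + 1) * (((d : ℝ) + 1) / 2)) := by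
  set T := t (Fin.last k) with hT
  have hT0 : 0 < T := ht _
  -- Forced by T^R ≤ t_1 ≤ T with R > 1.
  have hT1 : T ≤ 1 := by
    by_contra h
    have h1 : T ^ (1 : ℝ) < T ^ R := Real.rpow_lt_rpow_of_exponent_lt (not_le.1 h) hR
    rw [Real.rpow_one] at h1
    exact absurd (htR.trans (hmono (Fin.zero_le _))) (not_le.2 h1)
  calc ∏ e, t e ^ (-(j e : ℝ) - ((d : ℝ) + 1) / 2)
      ≤ ∏ e, T ^ (R * (-(j e : ℝ) - ((d : ℝ) + 1) / 2)) := by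
        refine Finset.prod_le_prod (fun e _ => (Real.rpow_pos_of_pos (ht e) _).le) fun e _ => ?_
        rw [Real.rpow_mul hT0.le]
        refine Real.rpow_le_rpow_of_nonpos (Real.rpow_pos_of_pos hT0 _)
          (htR.trans (hmono (Fin.zero_le e))) ?_
        have h1 : (0 : ℝ) ≤ j e := Nat.cast_nonneg _
        have h2 : (0 : ℝ) ≤ ((d : ℝ) + 1) / 2 := by positivity
        linarith
    _ = T ^ (∑ e, R * (-(j e : ℝ) - ((d : ℝ) + 1) / 2)) := (Real.rpow_sum_of_pos hT0 _ _).symm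
    _ ≤ _ := by
        refine Real.rpow_le_rpow_of_exponent_ge hT0 hT1 ?_
        rw [← Finset.mul_sum, Finset.sum_sub_distrib, Finset.sum_neg_distrib, Finset.sum_const,
          Finset.card_univ, Fintype.card_fin, nsmul_eq_mul]
        have h1 : ∑ e, (j e : ℝ) ≤ O := by exact_mod_cast hj
        have h2 : R * ∑ e, (j e : ℝ) ≤ R * O :=
          mul_le_mul_of_nonneg_left h1 (zero_lt_one.trans hR).le
        push_cast
        linarith

end StableGraph

end

/-! ### Summation over β and J -/

theorem mainTheorem3 {d m k l : ℕ} (γ : StableGraph (m + 1) (k + 1) l)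
    (I : ∀ i r : ℕ, LocalFunctional d r)
    {F : Finset (Fin (k + 1))} (hF : γ.IsSpanningTree F) (N : ℕ) :
    ∃ C : (Fin l → ℕ) → ℝ, (∀ p, 0 ≤ C p) ∧
      ∀ R : ℝ, 1 < R →
      ∀ t : Fin (k + 1) → ℝ, (∀ e, 0 < t e) → Monotone t → t (Fin.last k) ^ R ≤ t 0 →
      ∀ α : Pt d → ℝ, ContDiff ℝ ∞ α → HasCompactSupport α →
        IntegrableOn (γ.weightIntegrand I t α) (halfSpaceConfig d (m + 1)) ∧
        (∀ (β : Fin (k + 1) → ℤˣ) (j : Fin (k + 1) → ℕ),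
          IntegrableOn (γ.taylorIntegrand hF I N t α β j) (halfSpaceConfig d (m + 1))) ∧
        |γ.weight I t α - γ.taylorWeight hF I N t α| ≤
          (∑ p ∈ multiIndices (Fin l) (γ.totalOrder I + N + 1), C p * ∏ h, CpNorm (p h) α) *
            t (Fin.last k) ^
              (((N : ℝ) + 1) / 2 + (m : ℝ) * (((d : ℝ) + 1) / 2) - R * (γ.totalOrder I : ℝ)
                - R * ((k : ℝ) + 1) * (((d : ℝ) + 1) / 2)) := by
  obtain ⟨C, hC0, hC⟩ := γ.exists_integral_sub_taylor_le hF I N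
  set J := multiIndices (Fin (k + 1)) (γ.totalOrder I) with hJ
  -- One constant serves all p: the bound for a single integral, once for each pair (β, j).
  refine ⟨fun _ => ∑ _β : Fin (k + 1) → ℤˣ, ∑ _j ∈ J, C,
    fun _ => Finset.sum_nonneg fun _ _ => Finset.sum_nonneg fun _ _ => hC0,
    fun R hR t ht hmono htR α hα hc => ?_⟩
  have hexp : γ.weightIntegrand I t α = fun x => ∑ β : Fin (k + 1) → ℤˣ, ∑ j ∈ J,
      (∏ e, t e ^ (-(j e : ℝ) - ((d : ℝ) + 1) / 2)) *
        (Real.exp (-γ.quadForm β t x) * γ.Phi I α β j x) :=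
    funext (γ.weightIntegrand_eq_sum I ht α)
  have hint : ∀ (β : Fin (k + 1) → ℤˣ) (j : Fin (k + 1) → ℕ), Integrable
      (fun x => (∏ e, t e ^ (-(j e : ℝ) - ((d : ℝ) + 1) / 2)) *
        (Real.exp (-γ.quadForm β t x) * γ.Phi I α β j x))
      (volume.restrict (halfSpaceConfig d (m + 1))) := fun β j =>
    ((γ.integrable_exp_mul_Phi I hα t β j).const_mul _).integrableOn
  refine ⟨?_, fun β j => γ.integrableOn_taylorIntegrand hF I N ht hα β j, ?_⟩
  · rw [hexp]
    exact integrable_finsetSum _ fun β _ => integrable_finsetSum _ fun j _ => hint β j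
  set S := ∑ p ∈ multiIndices (Fin l) (γ.totalOrder I + N + 1), ∏ h, CpNorm (p h) α with hS
  have hS0 : 0 ≤ S := Finset.sum_nonneg fun p _ => Finset.prod_nonneg fun h _ => CpNorm_nonneg _ _
  set T := t (Fin.last k) with hT
  have hT0 : 0 < T := ht _
  have hw : γ.weight I t α = ∑ β : Fin (k + 1) → ℤˣ, ∑ j ∈ J,
      (∏ e, t e ^ (-(j e : ℝ) - ((d : ℝ) + 1) / 2)) *
        ∫ x in halfSpaceConfig d (m + 1), Real.exp (-γ.quadForm β t x) * γ.Phi I α β j x := by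
    rw [StableGraph.weight, hexp, integral_finsetSum _ fun β _ =>
      integrable_finsetSum _ fun j _ => hint β j]
    refine Finset.sum_congr rfl fun β _ => ?_
    rw [integral_finsetSum _ fun j _ => hint β j]
    exact Finset.sum_congr rfl fun j _ => integral_const_mul _ _
  rw [hw, StableGraph.taylorWeight, ← Finset.sum_sub_distrib, ← Finset.mul_sum, ← hS,
    Finset.sum_mul, Finset.sum_mul]
  refine (Finset.abs_sum_le_sum_abs _ _).trans (Finset.sum_le_sum fun β _ => ?_)
  rw [← Finset.sum_sub_distrib, Finset.sum_mul, Finset.sum_mul]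
  refine (Finset.abs_sum_le_sum_abs _ _).trans (Finset.sum_le_sum fun j hj => ?_)
  rw [← mul_sub, abs_mul, abs_of_nonneg (Finset.prod_nonneg fun e _ =>
    (Real.rpow_pos_of_pos (ht e) _).le)]
  refine (mul_le_mul (StableGraph.prod_rpow_le ht hmono hR htR (Finset.mem_filter.1 hj).2 d)
    (hC β j hj t ht T (fun e => hmono (Fin.le_last e)) α hα hc) (abs_nonneg _)
    (Real.rpow_pos_of_pos hT0 _).le).trans_eq ?_
  rw [mul_comm, mul_assoc, ← Real.rpow_add hT0]
  congr 2
  ring
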